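/- Setting. Let $\mathcal G=(V,\mathcal I,\mathcal E,\partial)$ be a finite connected graph without tadpoles, with vertex set $V$, internal lines $\mathcal I$ (each $i\in\mathcal I$ has an initial vertex $\partial^-(i)$ and a terminal vertex $\partial^+(i)\neq\partial^-(i)$; multiple lines are allowed) and a nonempty set $\mathcal E$ of external lines (half-lines, $e$ being attached to the vertex $\partial(e)$). Let $a=(a_i)_{i\in\mathcal I}$, $a_i>0$, be the lengths of the internal lines. Let $\mathcal K=\mathbb C^{\mathcal E}\oplus\mathbb C^{\mathcal I}\oplus\mathbb C^{\mathcal I}$, whose coordinates correspond to the external lines, the initial ends and the terminal ends of the internal lines, and let $A,B$ be linear maps on $\mathcal K$ such that $(A,B)$ has maximal rank and $AB^\dagger$ is self-adjoint. Assume that the boundary conditions $(A,B)$ are local: writing $\mathcal K=\bigoplus_{v\in V}\mathcal L_v$, where $\mathcal L_v$ is spanned by the coordinates of the line ends at $v$, there are an invertible $C$ and linear maps $A(v),B(v)$ on $\mathcal L_v$ with $CA=\bigoplus_v A(v)$ and $CB=\bigoplus_v B(v)$. Scattering matrix. For $k\in\mathbb C$ and $b\in\mathbb R^{\mathcal I}$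 let $S(k;A,B,b)$ be the $\mathcal E\times\mathcal E$ matrix $S$ for which there are $\mathcal I\times\mathcal E$ matrices $\alpha,\beta$ with $$\bigl(AX+\mathrm i k BY\bigr)\begin{pmatrix}S\\ \alpha\\ \beta\end{pmatrix}=-(A-\mathrm i kB)\begin{pmatrix}\mathbb I\\0\\0\end{pmatrix},\quad X=\begin{pmatrix}\mathbb I&0&0\\0&\mathbb I&\mathbb I\\0&\mathrm e^{\mathrm i kb}&\mathrm e^{-\mathrm i kb}\end{pmatrix},\quad Y=\begin{pmatrix}\mathbb I&0&0\\0&\mathbb I&-\mathbb I\\0&-\mathrm e^{\mathrm i kb}&\mathrm e^{-\mathrm i kb}\end{pmatrix},$$ where $\mathrm e^{\pm\mathrm i kb}$ is the diagonal matrix with entries $\mathrm e^{\pm\mathrm i kb_i}$. (At points $k$ where such an $S$ does not exist or is not unique, its value is chosen arbitrarily.) Walks. A walk from $e'\in\mathcal E$ to $e\in\mathcal E$ is a sequence $w=\{e',i_1,\dots,i_N,e\}$, $N\ge 0$, $i_j\in\mathcal I$, for which there are vertices $v_0=\partial(e')$, $v_1,\dots,v_N=\partial(e)$ such that for every $1\le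 j\le N$ the vertices $v_{j-1}\ne v_j$ are both incident with $i_j$. Its score is $n(w)=(n_i(w))_{i\in\mathcal I}$, $n_i(w)$ being the number of $j$ with $i_j=i$, and $\mathcal N_{e,e'}$ is the set of scores of all walks from $e'$ to $e$. With $S_v(k)=-(A(v)+\mathrm i kB(v))^{-1}(A(v)-\mathrm i kB(v))$ and $i_0:=e'$, $i_{N+1}:=e$, put $$\widetilde W(w;k)=\prod_{j=0}^{N}[S_{v_j}(k)]_{i_{j+1},i_j},\qquad [\widehat S_n(k;A,B)]_{e,e'}=\sum_{w:\,n(w)=n}\widetilde W(w;k)\qquad(n\in\mathbb N_0^{\mathcal I}),$$ where the index $i_j$ stands for the coordinate of $\mathcal L_v$ that belongs to the end of $i_j$ at $v$, the last sum is over walks from $e'$ to $e$, and $\langle n,a\rangle=\sum_i n_ia_i$. Theorem. (a) $S(k;A,B,b)$ exists and is unique for all $k>0$ and $b\in\mathbb R^{\mathcal I}$, and so does $S(k;A,B,a)$ for all $k\in\mathbb C$ with $\operatorname{Re}k>0$, $\operatorname{Im}k>0$. The entries of $k\mapsto S(k;A,B,a)$ are meromorphic on $\mathbb C$ and analytic on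 $\{\operatorname{Re}k>0,\ \operatorname{Im}k>0\}$; thus the values at complex $k$ are the analytic continuation of those at $k>0$. (b) For all $n\in\mathbb N_0^{\mathcal I}$ and $e,e'\in\mathcal E$ the function $k\mapsto[\widehat S_n(k;A,B)]_{e,e'}$ is analytic on $\{\operatorname{Re}k>0\}$, and for $k>0$ it is the $n$-th Fourier coefficient of the scattering matrix with respect to the lengths (with integrable integrand), $$[\widehat S_n(k;A,B)]_{e,e'}=\Bigl(\frac{k}{2\pi}\Bigr)^{|\mathcal I|}\int_{[0,2\pi/k]^{\mathcal I}}S(k;A,B,b)_{e,e'}\,\mathrm e^{-\mathrm i k\langle n,b\rangle}\,db .$$ (c) There is $\beta_0>0$ such that for all $k\in\mathbb C$ with $\operatorname{Re}k>0$ and $\operatorname{Im}k>\beta_0$ and all $e,e'\in\mathcal E$ $$S(k;A,B,a)_{e,e'}=\sum_{n\in\mathcal N_{e,e'}}[\widehat S_n(k;A,B)]_{e,e'}\,\mathrm e^{\mathrm i k\langle n,a\rangle},$$ the series being absolutely convergent. -/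

import Mathlib

/-- A finite graph with vertex set `V`, internal lines `I`, external lines `E` (half-lines) and
boundary operator `∂(i) = (init i, term i)` for internal lines, `∂(e) = ext e` for external lines.
Multiple lines are allowed, tadpoles are not. -/
structure LineGraph (V E I : Type*) where
  /-- the vertex an external line is attached to -/
  ext : E → V
  /-- the initial vertex of an internal line -/
  init : I → V
  /-- the terminal vertex of an internal line -/
  term : I → V
  no_tadpole : ∀ i, init i ≠ term i

namespace LineGraph

/-- Connectedness of the graph: any two vertices are joined by a path of internal lines. -/
def Connected {V E I : Type*} (G : LineGraph V E I) : Prop :=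
  (SimpleGraph.fromRel fun v w => ∃ i, G.init i = v ∧ G.term i = w).Connected

/-- The index set `E ⊕ I ⊕ I` of the coordinates of `𝒦 = 𝒦_E ⊕ 𝒦_I⁽⁻⁾ ⊕ 𝒦_I⁽⁺⁾` consists of the
ends of the lines; this is the vertex at which an end sits. -/
def vert {V E I : Type*} (G : LineGraph V E I) : E ⊕ (I ⊕ I) → V :=
  Sum.elim G.ext (Sum.elim G.init G.term)

/-- The star of `v`: as there are no tadpoles, the lines incident with `v` are in bijection with
the line ends that sit at `v`. -/
abbrev Star {V E I : Type*} (G : LineGraph V E I) (v : V) : Type _ :=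
  {h : E ⊕ (I ⊕ I) // G.vert h = v}

/-- The direct sum `⨁ᵥ M(v)` of matrices acting in the subspaces `ℒ_v` of `𝒦 = ⨁ᵥ ℒ_v`. -/
def starSum {V E I : Type*} [DecidableEq V] (G : LineGraph V E I)
    (M : ∀ v, Matrix (G.Star v) (G.Star v) ℂ) : Matrix (E ⊕ (I ⊕ I)) (E ⊕ (I ⊕ I)) ℂ :=
  fun h h' => if p : G.vert h' = G.vert h then M (G.vert h) ⟨h, rfl⟩ ⟨h', p⟩ else 0

/-- Incidence of a vertex and an internal line. -/
def Incident {V E I : Type*} (G : LineGraph V E I) (v : V) (i : I) : Prop :=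
  v = G.init i ∨ v = G.term i

/-- The end at `v` of an internal line `i` incident with `v`. -/
def lineEnd {V E I : Type*} [DecidableEq V] (G : LineGraph V E I) (i : I) (v : V) :
    E ⊕ (I ⊕ I) :=
  if v = G.init i then Sum.inr (Sum.inl i) else Sum.inr (Sum.inr i)

/-- Walks `{e', i₁, …, i_N, e}` from `e'` to `e`, together with the sequence `v₀, …, v_N` of
vertices visited (which is determined by the lines). Here `edge j` is `i_{j+1}`. The case `N = 0`
is the trivial walk, which exists iff `∂(e') = ∂(e)`. -/
structure Walk {V E I : Type*} (G : LineGraph V E I) (e' e : E) where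
  /-- the combinatorial length `N` -/
  length : ℕ
  /-- the internal lines traversed -/
  edge : Fin length → I
  /-- the vertices visited -/
  vertex : Fin (length + 1) → V
  start : vertex 0 = G.ext e'
  finish : vertex (Fin.last length) = G.ext e
  incident_left : ∀ j : Fin length, G.Incident (vertex j.castSucc) (edge j)
  incident_right : ∀ j : Fin length, G.Incident (vertex j.succ) (edge j)
  ne : ∀ j : Fin length, vertex j.castSucc ≠ vertex j.succ

namespace Walk

/-- The score: the number of times each internal line is traversed. -/
def score {V E I : Type*} [DecidableEq I] {G : LineGraph V E I} {e' e : E} (w : G.Walk e' e) :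
    I → ℕ :=
  fun i => (Finset.univ.filter fun j => w.edge j = i).card

/-- The line end through which the walk arrives at its `k`-th vertex: that of `e'` for `k = 0`
and that of `i_k` otherwise. -/
def incoming {V E I : Type*} [DecidableEq V] {G : LineGraph V E I} {e' e : E}
    (w : G.Walk e' e) : Fin (w.length + 1) → E ⊕ (I ⊕ I) :=
  Fin.cons (Sum.inl e') fun j => G.lineEnd (w.edge j) (w.vertex j.succ)

/-- The line end through which the walk leaves its `k`-th vertex: that of `e` for `k = N` and
that of `i_{k+1}` otherwise. -/
def outgoing {V E I : Type*} [DecidableEq V] {G : LineGraph V E I} {e' e : E}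
    (w : G.Walk e' e) : Fin (w.length + 1) → E ⊕ (I ⊕ I) :=
  Fin.snoc (fun j => G.lineEnd (w.edge j) (w.vertex j.castSucc)) (Sum.inl e)

end Walk

/-- The set `𝒩_{e,e'}` of scores of all walks from `e'` to `e`. -/
def scores {V E I : Type*} [DecidableEq I] (G : LineGraph V E I) (e e' : E) : Set (I → ℕ) :=
  {n | ∃ w : G.Walk e' e, w.score = n}

/-- Admissible boundary conditions `A ψ + B ψ' = 0`: `(A, B)` has maximal rank and `A B†` is
self-adjoint. -/
def IsAdmissible {E I : Type*} [Fintype E] [Fintype I]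
    (A B : Matrix (E ⊕ (I ⊕ I)) (E ⊕ (I ⊕ I)) ℂ) : Prop :=
  (Matrix.fromCols A B).rank = Fintype.card (E ⊕ (I ⊕ I)) ∧ (A * B.conjTranspose).IsHermitian

/-- Local boundary conditions, with vertex boundary conditions `A(v)`, `B(v)`: for some invertible
`C` one has `C A = ⨁ᵥ A(v)` and `C B = ⨁ᵥ B(v)`. -/
def IsLocalWith {V E I : Type*} [Fintype E] [Fintype I] [DecidableEq V] [DecidableEq E]
    [DecidableEq I] (G : LineGraph V E I) (A B : Matrix (E ⊕ (I ⊕ I)) (E ⊕ (I ⊕ I)) ℂ)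
    (Av Bv : ∀ v, Matrix (G.Star v) (G.Star v) ℂ) : Prop :=
  ∃ C : Matrix (E ⊕ (I ⊕ I)) (E ⊕ (I ⊕ I)) ℂ,
    IsUnit C ∧ C * A = G.starSum Av ∧ C * B = G.starSum Bv

/-- The diagonal matrix `e^{z a}`. -/
noncomputable def expDiag {I : Type*} [DecidableEq I] (z : ℂ) (a : I → ℝ) : Matrix I I ℂ :=
  Matrix.diagonal fun i => Complex.exp (z * (a i : ℂ))

/-- The matrix `X(k; a)`: it sends the amplitudes `(s, α, β)` of the functions `s_e e^{ikx}` on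
the external and `α_i e^{ikx} + β_i e^{-ikx}` on the internal lines to their boundary values. -/
noncomputable def matX {E I : Type*} [DecidableEq E] [DecidableEq I] (k : ℂ) (a : I → ℝ) :
    Matrix (E ⊕ (I ⊕ I)) (E ⊕ (I ⊕ I)) ℂ :=
  Matrix.fromBlocks 1 0 0
    (Matrix.fromBlocks 1 1 (expDiag (Complex.I * k) a) (expDiag (-(Complex.I * k)) a))

/-- The matrix `Y(k; a)`: `i k Y(k; a)` sends the amplitudes `(s, α, β)` to the boundary values of
the inward derivatives. -/
noncomputable def matY {E I : Type*} [DecidableEq E] [DecidableEq I] (k : ℂ) (a : I → ℝ) :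
    Matrix (E ⊕ (I ⊕ I)) (E ⊕ (I ⊕ I)) ℂ :=
  Matrix.fromBlocks 1 0 0
    (Matrix.fromBlocks 1 (-1) (-expDiag (Complex.I * k) a) (expDiag (-(Complex.I * k)) a))

/-- `Z(k; A, B, a) = A X(k; a) + i k B Y(k; a)`. -/
noncomputable def matZ {E I : Type*} [Fintype E] [Fintype I] [DecidableEq E] [DecidableEq I]
    (A B : Matrix (E ⊕ (I ⊕ I)) (E ⊕ (I ⊕ I)) ℂ) (k : ℂ) (a : I → ℝ) :
    Matrix (E ⊕ (I ⊕ I)) (E ⊕ (I ⊕ I)) ℂ :=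
  A * matX k a + (Complex.I * k) • (B * matY k a)

/-- `S` is a scattering matrix at `k`: with suitable interior amplitudes `α`, `β`, the functions
equal to `δ_{je'} e^{-ikx} + S_{je'} e^{ikx}` on the external lines `j` and to
`α_{je'} e^{ikx} + β_{je'} e^{-ikx}` on the internal lines `j` satisfy the boundary conditions for
every `e'`, that is, `Z (S, α, β)ᵀ = -(A - i k B) (1, 0, 0)ᵀ`. -/
def IsScatteringMatrix {E I : Type*} [Fintype E] [Fintype I] [DecidableEq E] [DecidableEq I]
    (A B : Matrix (E ⊕ (I ⊕ I)) (E ⊕ (I ⊕ I)) ℂ) (k : ℂ) (a : I → ℝ) (S : Matrix E E ℂ) : Prop :=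
  ∃ α β : Matrix I E ℂ,
    matZ A B k a * Matrix.fromRows S (Matrix.fromRows α β) =
      -((A - (Complex.I * k) • B) *
        Matrix.fromRows (1 : Matrix E E ℂ) (0 : Matrix (I ⊕ I) E ℂ))

/-- The scattering matrix `S(k; A, B, a)`. -/
noncomputable def scatteringMatrix {E I : Type*} [Fintype E] [Fintype I] [DecidableEq E]
    [DecidableEq I] (A B : Matrix (E ⊕ (I ⊕ I)) (E ⊕ (I ⊕ I)) ℂ) (k : ℂ) (a : I → ℝ) :
    Matrix E E ℂ :=
  Classical.epsilon fun S => IsScatteringMatrix A B k a S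

/-- The scattering matrix `S_v(k) = -(A(v) + i k B(v))⁻¹ (A(v) - i k B(v))` of the single-vertex
graph at `v`. -/
noncomputable def vertexScattering {V E I : Type*} [Fintype E] [Fintype I] [DecidableEq V]
    [DecidableEq E] [DecidableEq I] (G : LineGraph V E I)
    (Av Bv : ∀ v, Matrix (G.Star v) (G.Star v) ℂ) (k : ℂ) (v : V) :
    Matrix (G.Star v) (G.Star v) ℂ :=
  -((Av v + (Complex.I * k) • Bv v)⁻¹ * (Av v - (Complex.I * k) • Bv v))

/-- The weight `∏_{j=0}^{N} S_{v_j}(k)_{out_j, in_j}` of a walk, where `in_j` and `out_j` are the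
ends at `v_j` of the lines through which the walk arrives at and leaves `v_j`. -/
noncomputable def Walk.weight {V E I : Type*} [Fintype E] [Fintype I] [DecidableEq V]
    [DecidableEq E] [DecidableEq I] {G : LineGraph V E I}
    (Av Bv : ∀ v, Matrix (G.Star v) (G.Star v) ℂ) (k : ℂ) {e' e : E} (w : G.Walk e' e) : ℂ :=
  ∏ j, G.starSum (G.vertexScattering Av Bv k) (w.outgoing j) (w.incoming j)

/-- The coefficient `Ŝ_n(k)_{e,e'}` at complex `k`: the (finite) sum of the weights of the walks
from `e'` to `e` with score `n`. -/
noncomputable def walkCoeff {V E I : Type*} [Fintype E] [Fintype I] [DecidableEq V]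
    [DecidableEq E] [DecidableEq I] (G : LineGraph V E I)
    (Av Bv : ∀ v, Matrix (G.Star v) (G.Star v) ℂ) (k : ℂ) (n : I → ℕ) (e e' : E) : ℂ :=
  ∑ᶠ (w : G.Walk e' e) (_ : w.score = n), w.weight Av Bv k

/-- `⟨n, a⟩ = ∑ᵢ nᵢ aᵢ`. -/
def pairing {I : Type*} [Fintype I] (n : I → ℕ) (a : I → ℝ) : ℝ := ∑ i, (n i : ℝ) * a i

/-- The integrand `S(k; A, B, b)_{e,e'} e^{-i k ⟨n, b⟩}` of the Fourier coefficients. -/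
noncomputable def fourierIntegrand {E I : Type*} [Fintype E] [Fintype I] [DecidableEq E]
    [DecidableEq I] (A B : Matrix (E ⊕ (I ⊕ I)) (E ⊕ (I ⊕ I)) ℂ) (k : ℝ) (n : I → ℕ) (e e' : E)
    (b : I → ℝ) : ℂ :=
  scatteringMatrix A B (k : ℂ) b e e' * Complex.exp (-(Complex.I * k * (pairing n b : ℂ)))

/-- The Fourier coefficient, for `k > 0`, of the scattering matrix as a function of the lengths:
`(k / 2π)^{|I|} ∫_{[0, 2π/k]^I} S(k; A, B, b)_{e,e'} e^{-i k ⟨n, b⟩} db`. -/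
noncomputable def fourierCoeff {E I : Type*} [Fintype E] [Fintype I] [DecidableEq E]
    [DecidableEq I] (A B : Matrix (E ⊕ (I ⊕ I)) (E ⊕ (I ⊕ I)) ℂ) (k : ℝ) (n : I → ℕ) (e e' : E) :
    ℂ :=
  ((k / (2 * Real.pi)) ^ Fintype.card I : ℝ) *
    ∫ b in Set.Icc (0 : I → ℝ) (fun _ => 2 * Real.pi / k), fourierIntegrand A B k n e e' b

end LineGraph

set_option linter.unusedSectionVars false

/-! At every line end a solution is split into the amplitude leaving the vertex and the amplitude
arriving there. Arriving amplitudes come from leaving ones by `hop`, which carries them to the other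
end of the line with a factor e^{ikb_i}, plus the incoming wave on an external line. In these
unknowns the defining system reads (1 - M hop) O = M (1, 0, 0)ᵀ with M = -(A + ikB)⁻¹(A - ikB), and
locality makes M the direct sum of the S_v(k). The Neumann series ∑ (M hop)^N M is then a sum over
walks: matrix multiplication chooses a sequence of line ends, and a sequence that does not fit
together at the vertices has weight zero (`pow_mul_apply_inl_inl`). The rest is solvability and
convergence.

Solvability rests on a flux identity (`IsAdmissible.flux`): self-adjointness of AB† forces the flux
of admissible boundary values to vanish. Hence A + ikB is invertible for Re k > 0. If also Im k > 0,
decay along the lines makes the whole system invertible (`line_flux_ge`), and Cramer's rule gives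
analyticity and meromorphy. For k > 0 the matrix M is unitary; 1 - M hop may be singular, but its
kernel vanishes on the external lines, and the Fredholm alternative still produces a unique S.

For k > 0 the Neumann series need not converge, so it is Abel summed with factors r^N. The Abel sums
are bounded by 1 and tend to S as r → 1, so dominated convergence reduces the Fourier coefficient of
S to those of the damped series, which are computed term by term.

For the expansion, the entries of M are rational in k and bounded by 1 on k > 0, hence bounded for
large |k| in the right half-plane (`IsAdmissible.exists_norm_apply_le`). For large Im k all factors
e^{ika_i} are small, the sum over walks converges absolutely and may be regrouped by score. This
works directly at complex k, without continuation from the real axis. -/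

namespace LineGraph

/-! ### Reformulation in terms of amplitudes leaving and arriving at the vertices. -/

section Transfer

variable {E I : Type*} [Fintype E] [Fintype I] [DecidableEq E] [DecidableEq I]

/-- The matrix that moves amplitudes from one end of an internal line to the other, with
weight `z i` on the line `i`. -/
def hop (E : Type*) {I : Type*} [DecidableEq I] (z : I → ℂ) :
    Matrix (E ⊕ (I ⊕ I)) (E ⊕ (I ⊕ I)) ℂ :=
  Matrix.fromBlocks 0 0 0 (Matrix.fromBlocks 0 (Matrix.diagonal z) (Matrix.diagonal z) 0)

/-- The diagonal matrix with entries `w` at the terminal ends and `1` elsewhere. -/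
def phase (E : Type*) {I : Type*} [DecidableEq E] [DecidableEq I] (w : I → ℂ) :
    Matrix (E ⊕ (I ⊕ I)) (E ⊕ (I ⊕ I)) ℂ :=
  Matrix.fromBlocks 1 0 0 (Matrix.fromBlocks 1 0 0 (Matrix.diagonal w))

/-- The factors `e^{i k b}` picked up along the internal lines. -/
noncomputable def lineFactor {I : Type*} (k : ℂ) (b : I → ℝ) (i : I) : ℂ :=
  Complex.exp (Complex.I * k * b i)

/-- The inclusion of the amplitudes on the external lines. -/
def extIncl (E I : Type*) [DecidableEq E] : Matrix (E ⊕ (I ⊕ I)) E ℂ :=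
  Matrix.fromRows (1 : Matrix E E ℂ) (0 : Matrix (I ⊕ I) E ℂ)

theorem lineFactor_mul_exp_neg {I : Type*} (k : ℂ) (b : I → ℝ) (i : I) :
    lineFactor k b i * Complex.exp (-(Complex.I * k * b i)) = 1 := by
  rw [lineFactor, ← Complex.exp_add]
  simp

/-- The factor `phase` evaluates the wave β e^{-ikx} at the terminal end, where it leaves the
vertex. After it all coordinates are leaving amplitudes, `hop` turns them into arriving ones, and a
boundary value is the sum of the two. For derivatives the sum becomes a difference, as in `matY_eq`.
-/
theorem matX_eq (k : ℂ) (b : I → ℝ) :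
    (matX k b : Matrix (E ⊕ (I ⊕ I)) _ ℂ) = (1 + hop E (lineFactor k b)) *
      phase E (fun i => Complex.exp (-(Complex.I * k) * b i)) := by
  rw [matX, hop, phase, ← Matrix.fromBlocks_one, ← Matrix.fromBlocks_one, Matrix.fromBlocks_add,
    Matrix.fromBlocks_add, Matrix.fromBlocks_multiply, Matrix.fromBlocks_multiply]
  simp [expDiag, lineFactor_mul_exp_neg, Matrix.fromBlocks_inj]
  exact fun _ => rfl

theorem matY_eq (k : ℂ) (b : I → ℝ) :
    (matY k b : Matrix (E ⊕ (I ⊕ I)) _ ℂ) = (1 - hop E (lineFactor k b)) *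
      phase E (fun i => Complex.exp (-(Complex.I * k) * b i)) := by
  rw [matY, hop, phase, ← Matrix.fromBlocks_one, ← Matrix.fromBlocks_one, sub_eq_add_neg,
    Matrix.fromBlocks_neg, Matrix.fromBlocks_neg, Matrix.fromBlocks_add,
    Matrix.fromBlocks_add, Matrix.fromBlocks_multiply, Matrix.fromBlocks_multiply]
  simp [expDiag, lineFactor_mul_exp_neg, Matrix.fromBlocks_inj]
  refine ⟨?_, fun _ => rfl⟩
  rw [← Matrix.diagonal_one, Matrix.diagonal_neg]

theorem matZ_eq (A B : Matrix (E ⊕ (I ⊕ I)) (E ⊕ (I ⊕ I)) ℂ) (k : ℂ) (b : I → ℝ) :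
    matZ A B k b = ((A + (Complex.I * k) • B) +
      (A - (Complex.I * k) • B) * hop E (lineFactor k b)) *
      phase E (fun i => Complex.exp (-(Complex.I * k) * b i)) := by
  rw [matZ, matX_eq, matY_eq, ← Matrix.mul_assoc, ← Matrix.mul_assoc, ← Matrix.smul_mul,
    ← Matrix.add_mul]
  congr 1
  rw [Matrix.mul_add, Matrix.mul_sub, Matrix.sub_mul, Matrix.smul_mul, smul_sub, Matrix.mul_one,
    Matrix.mul_one]
  abel

theorem phase_mul_phase {w w' : I → ℂ} (h : ∀ i, w i * w' i = 1) :
    (phase E w * phase E w') = 1 := by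
  rw [phase, phase, Matrix.fromBlocks_multiply, Matrix.fromBlocks_multiply]
  simp [h]

theorem toRows₁_phase_mul (w : I → ℂ) (O : Matrix (E ⊕ (I ⊕ I)) E ℂ) :
    (phase E w * O).toRows₁ = O.toRows₁ := by
  conv_lhs => rw [← Matrix.fromRows_toRows O, phase, Matrix.fromBlocks_mul_fromRows]
  simp

/-- The change of unknowns by `phase` is invertible and does not touch the external rows, so S is
read off unchanged. -/
theorem isScatteringMatrix_iff (A B : Matrix (E ⊕ (I ⊕ I)) (E ⊕ (I ⊕ I)) ℂ) (k : ℂ) (b : I → ℝ)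
    (S : Matrix E E ℂ) :
    IsScatteringMatrix A B k b S ↔ ∃ O : Matrix (E ⊕ (I ⊕ I)) E ℂ, O.toRows₁ = S ∧
      ((A + (Complex.I * k) • B) + (A - (Complex.I * k) • B) * hop E (lineFactor k b)) * O =
        -((A - (Complex.I * k) • B) * extIncl E I) := by
  rw [IsScatteringMatrix, matZ_eq]
  constructor
  · rintro ⟨α, β, h⟩
    refine ⟨_, ?_, (Matrix.mul_assoc _ _ _).symm.trans h⟩
    rw [toRows₁_phase_mul, Matrix.toRows₁_fromRows]
  · rintro ⟨O, rfl, h⟩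
    have key : phase E (fun i => Complex.exp (-(Complex.I * k) * b i)) *
        (phase E (lineFactor k b) * O) = O := by
      rw [← Matrix.mul_assoc, phase_mul_phase, Matrix.one_mul]
      intro i
      rw [mul_comm, neg_mul, lineFactor_mul_exp_neg]
    refine ⟨(phase E (lineFactor k b) * O).toRows₂.toRows₁,
      (phase E (lineFactor k b) * O).toRows₂.toRows₂, ?_⟩
    have : Matrix.fromRows O.toRows₁ (Matrix.fromRows
        (phase E (lineFactor k b) * O).toRows₂.toRows₁
        (phase E (lineFactor k b) * O).toRows₂.toRows₂) = phase E (lineFactor k b) * O := by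
      rw [Matrix.fromRows_toRows, ← toRows₁_phase_mul (lineFactor k b), Matrix.fromRows_toRows]
    rw [this, Matrix.mul_assoc, key, h]
    rfl

theorem add_sub_hop_eq {A B M : Matrix (E ⊕ (I ⊕ I)) (E ⊕ (I ⊕ I)) ℂ} {k : ℂ}
    (hM : (A + (Complex.I * k) • B) * M = -(A - (Complex.I * k) • B)) (z : I → ℂ) :
    (A + (Complex.I * k) • B) + (A - (Complex.I * k) • B) * hop E z =
      (A + (Complex.I * k) • B) * (1 - M * hop E z) := by
  rw [Matrix.mul_sub, ← Matrix.mul_assoc, hM, Matrix.mul_one, Matrix.neg_mul, sub_neg_eq_add]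

theorem isScatteringMatrix_iff' {A B M : Matrix (E ⊕ (I ⊕ I)) (E ⊕ (I ⊕ I)) ℂ} {k : ℂ}
    (hu : IsUnit (A + (Complex.I * k) • B))
    (hM : (A + (Complex.I * k) • B) * M = -(A - (Complex.I * k) • B)) (b : I → ℝ)
    (S : Matrix E E ℂ) :
    IsScatteringMatrix A B k b S ↔ ∃ O : Matrix (E ⊕ (I ⊕ I)) E ℂ, O.toRows₁ = S ∧
      (1 - M * hop E (lineFactor k b)) * O = M * extIncl E I := by
  rw [isScatteringMatrix_iff]
  refine exists_congr fun O => and_congr_right fun _ => ?_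
  rw [add_sub_hop_eq hM, ← Matrix.neg_mul, ← hM, Matrix.mul_assoc, Matrix.mul_assoc]
  constructor
  · intro h
    have := congrArg ((A + (Complex.I * k) • B)⁻¹ * ·) h
    have hd := (Matrix.isUnit_iff_isUnit_det _).1 hu
    simpa [← Matrix.mul_assoc, Matrix.nonsing_inv_mul _ hd] using this
  · intro h
    rw [h]

end Transfer

/-! ### Flux identity and its consequences for invertibility and unitarity. -/

section Lagrangian

variable {E I : Type*} [Fintype E] [Fintype I] [DecidableEq E] [DecidableEq I]
  {A B : Matrix (E ⊕ (I ⊕ I)) (E ⊕ (I ⊕ I)) ℂ}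

open Matrix
open scoped ComplexOrder

theorem IsAdmissible.mul_conjTranspose_eq (h : IsAdmissible A B) : B * Aᴴ = A * Bᴴ := by
  have := h.2
  rw [Matrix.IsHermitian, conjTranspose_mul, conjTranspose_conjTranspose] at this
  exact this

/-- This is (A B)(A B)†, which has the same rank as (A B). -/
theorem IsAdmissible.isUnit_gram (h : IsAdmissible A B) : IsUnit (A * Aᴴ + B * Bᴴ) := by
  have h1 : (A * Aᴴ + B * Bᴴ).rank = Fintype.card (E ⊕ (I ⊕ I)) := by
    rw [← h.1, ← rank_self_mul_conjTranspose (fromCols A B),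
      conjTranspose_fromCols_eq_fromRows_conjTranspose, fromCols_mul_fromRows]
  have h2 : Function.Surjective (A * Aᴴ + B * Bᴴ).mulVecLin := by
    rw [← LinearMap.range_eq_top]
    apply Submodule.eq_top_of_finrank_eq
    rw [← Matrix.rank, h1, Module.finrank_fintype_fun_eq_card]
  rw [← mulVec_injective_iff_isUnit]
  exact LinearMap.injective_iff_surjective.2 h2

/-- The boundary values that satisfy admissible boundary conditions form a Lagrangian subspace. -/
theorem IsAdmissible.exists_eq_mulVec (h : IsAdmissible A B) {x y : E ⊕ (I ⊕ I) → ℂ}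
    (hxy : A *ᵥ x + B *ᵥ y = 0) : ∃ u, x = -(Bᴴ *ᵥ u) ∧ y = Aᴴ *ᵥ u := by
  set G := A * Aᴴ + B * Bᴴ with hG
  have hGu : IsUnit G.det := (Matrix.isUnit_iff_isUnit_det _).1 h.isUnit_gram
  have hc := h.mul_conjTranspose_eq
  -- With T = (A B; -B A), self-adjointness of AB† kills the off-diagonal blocks of T T†, leaving
  -- diag(G, G). So T† diag(G⁻¹, G⁻¹) also inverts T from the left; applied to T(x, y), whose first
  -- component is 0, it gives the asserted form.
  have h1 : fromBlocks A B (-B) A *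
      (fromBlocks A B (-B) A)ᴴ * fromBlocks G⁻¹ 0 0 G⁻¹ = 1 := by
    rw [fromBlocks_conjTranspose, fromBlocks_multiply, fromBlocks_multiply]
    simp only [conjTranspose_neg, Matrix.mul_neg, Matrix.neg_mul, neg_neg, hc, neg_add_cancel,
      add_comm (B * Bᴴ), ← hG, Matrix.mul_nonsing_inv _ hGu, Matrix.zero_mul,
      Matrix.mul_zero, add_zero, zero_add, fromBlocks_one]
  rw [Matrix.mul_assoc] at h1
  have h2 := mul_eq_one_comm.1 h1
  have h3 := congrArg (· *ᵥ Sum.elim x y) h2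
  simp only [one_mulVec, ← mulVec_mulVec, fromBlocks_mulVec, fromBlocks_conjTranspose,
    Sum.elim_comp_inl, Sum.elim_comp_inr, hxy, mulVec_zero, zero_mulVec, zero_add, add_zero,
    conjTranspose_neg, neg_mulVec] at h3
  refine ⟨G⁻¹ *ᵥ (-(B *ᵥ x) + A *ᵥ y), ?_, ?_⟩
  · exact ((Sum.elim_eq_iff.1 h3).1).symm
  · exact ((Sum.elim_eq_iff.1 h3).2).symm

theorem IsAdmissible.im_dotProduct_eq_zero (h : IsAdmissible A B) {x y : E ⊕ (I ⊕ I) → ℂ}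
    (hxy : A *ᵥ x + B *ᵥ y = 0) : (star x ⬝ᵥ y).im = 0 := by
  obtain ⟨u, rfl, rfl⟩ := h.exists_eq_mulVec hxy
  have := h.2.im_star_dotProduct_mulVec_self u
  rw [← h.mul_conjTranspose_eq] at this
  rw [star_neg, neg_dotProduct, star_mulVec, conjTranspose_conjTranspose, ← dotProduct_mulVec,
    mulVec_mulVec, Complex.neg_im, neg_eq_zero]
  exact this

/-- The flux identity for outgoing amplitudes `o` and incoming amplitudes `i`. -/
theorem IsAdmissible.flux (h : IsAdmissible A B) {k : ℂ} {o i : E ⊕ (I ⊕ I) → ℂ}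
    (hoi : (A + (Complex.I * k) • B) *ᵥ o + (A - (Complex.I * k) • B) *ᵥ i = 0) :
    ∑ x, (k.re * (‖o x‖ ^ 2 - ‖i x‖ ^ 2) - 2 * k.im * (star (i x) * o x).im) = 0 := by
  have h1 : A *ᵥ (o + i) + B *ᵥ ((Complex.I * k) • (o - i)) = 0 := by
    rw [← hoi]
    simp only [add_mulVec, sub_mulVec, mulVec_add, mulVec_smul, mulVec_sub, smul_mulVec, smul_sub]
    abel
  have h2 := h.im_dotProduct_eq_zero h1
  rw [dotProduct, Complex.im_sum] at h2
  rw [← h2]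
  refine Finset.sum_congr rfl fun x _ => ?_
  rw [← Complex.normSq_eq_norm_sq, ← Complex.normSq_eq_norm_sq, Complex.normSq_apply,
    Complex.normSq_apply]
  simp
  ring

/-- With no arriving amplitudes the flux identity reduces to Re k · ∑ |o|² = 0. -/
theorem IsAdmissible.isUnit_add (h : IsAdmissible A B) {k : ℂ} (hk : 0 < k.re) :
    IsUnit (A + (Complex.I * k) • B) := by
  rw [← mulVec_injective_iff_isUnit, ← coe_mulVecLin, ← LinearMap.ker_eq_bot, LinearMap.ker_eq_bot']
  intro o ho
  rw [mulVecLin_apply] at ho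
  have := h.flux (k := k) (o := o) (i := 0) (by rw [ho, mulVec_zero, add_zero])
  simp only [Pi.zero_apply, norm_zero, star_zero, zero_mul, Complex.zero_im, mul_zero, sub_zero,
    ne_eq, OfNat.ofNat_ne_zero, not_false_eq_true, zero_pow] at this
  rw [Finset.sum_eq_zero_iff_of_nonneg (fun x _ => by positivity)] at this
  ext x
  simpa [hk.ne'] using this x (Finset.mem_univ _)

/-- Follows from |sin t| ≤ t for t = xa and t < sinh t for t = κa. It says that the interference
term of the flux on a line of length a is smaller than the loss by decay, with k = x + iκ. -/
theorem exp_neg_mul_abs_sin_lt {x κ a : ℝ} (hx : 0 < x) (hκ : 0 < κ) (ha : 0 < a) :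
    2 * κ * (Real.exp (-(κ * a)) * |Real.sin (x * a)|) <
      x * (1 - Real.exp (-(κ * a)) ^ 2) := by
  have h1 : |Real.sin (x * a)| ≤ x * a := by
    have := Real.abs_sin_le_abs (x := x * a)
    rwa [abs_of_pos (by positivity : 0 < x * a)] at this
  have h2 : κ * a < Real.sinh (κ * a) := Real.self_lt_sinh_iff.2 (by positivity)
  have h3 : 1 - Real.exp (-(κ * a)) ^ 2 = 2 * Real.exp (-(κ * a)) * Real.sinh (κ * a) := by
    rw [Real.sinh_eq]
    have : Real.exp (-(κ * a)) * Real.exp (κ * a) = 1 := by rw [← Real.exp_add]; simp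
    linear_combination -this
  rw [h3]
  have he := Real.exp_pos (-(κ * a))
  calc 2 * κ * (Real.exp (-(κ * a)) * |Real.sin (x * a)|)
      ≤ 2 * κ * (Real.exp (-(κ * a)) * (x * a)) := by gcongr
    _ = 2 * x * Real.exp (-(κ * a)) * (κ * a) := by ring
    _ < 2 * x * Real.exp (-(κ * a)) * Real.sinh (κ * a) := by gcongr
    _ = _ := by ring

theorem hop_mulVec_inl (z : I → ℂ) (o : E ⊕ (I ⊕ I) → ℂ) (e : E) :
    (hop E z *ᵥ o) (Sum.inl e) = 0 := by
  rw [hop, fromBlocks_mulVec, Sum.elim_inl]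
  simp

theorem hop_mulVec_inr_inl (z : I → ℂ) (o : E ⊕ (I ⊕ I) → ℂ) (i : I) :
    (hop E z *ᵥ o) (Sum.inr (Sum.inl i)) = z i * o (Sum.inr (Sum.inr i)) := by
  rw [hop, fromBlocks_mulVec, fromBlocks_mulVec]
  simp [mulVec_diagonal]

theorem hop_mulVec_inr_inr (z : I → ℂ) (o : E ⊕ (I ⊕ I) → ℂ) (i : I) :
    (hop E z *ᵥ o) (Sum.inr (Sum.inr i)) = z i * o (Sum.inr (Sum.inl i)) := by
  rw [hop, fromBlocks_mulVec, fromBlocks_mulVec]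
  simp [mulVec_diagonal]

/-- On an internal line the amplitudes lose more flux by decay than the boundary conditions can
supply. -/
theorem line_flux_ge {k : ℂ} (hre : 0 < k.re) (him : 0 < k.im) {a : ℝ} (ha : 0 < a) :
    ∃ c > 0, ∀ u v : ℂ, c * (‖u‖ ^ 2 + ‖v‖ ^ 2) ≤
      (k.re * (‖u‖ ^ 2 - ‖Complex.exp (Complex.I * k * a) * v‖ ^ 2) -
        2 * k.im * (star (Complex.exp (Complex.I * k * a) * v) * u).im) +
      (k.re * (‖v‖ ^ 2 - ‖Complex.exp (Complex.I * k * a) * u‖ ^ 2) -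
        2 * k.im * (star (Complex.exp (Complex.I * k * a) * u) * v).im) := by
  -- The constant c is the gap between the two sides of that inequality.
  refine ⟨_, sub_pos.2 (exp_neg_mul_abs_sin_lt hre him ha), fun u v => ?_⟩
  have hn : ‖Complex.exp (Complex.I * k * a)‖ = Real.exp (-(k.im * a)) := by
    rw [Complex.norm_exp]; simp
  have hi : (Complex.exp (Complex.I * k * a)).im =
      Real.exp (-(k.im * a)) * Real.sin (k.re * a) := by
    rw [Complex.exp_im]; simp
  set z := Complex.exp (Complex.I * k * a)
  set ρ := Real.exp (-(k.im * a))
  set s := Real.sin (k.re * a)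
  have hρ : 0 < ρ := Real.exp_pos _
  rw [norm_mul, norm_mul, hn]
  have him' : (star (z * v) * u).im + (star (z * u) * v).im =
      -(2 * (ρ * s)) * (u.re * v.re + u.im * v.im) := by
    rw [← hi]
    simp
    ring
  have hb : 2 * |u.re * v.re + u.im * v.im| ≤ ‖u‖ ^ 2 + ‖v‖ ^ 2 := by
    rw [← Complex.normSq_eq_norm_sq, ← Complex.normSq_eq_norm_sq, Complex.normSq_apply,
      Complex.normSq_apply]
    rcases abs_cases (u.re * v.re + u.im * v.im) with ⟨h, _⟩ | ⟨h, _⟩ <;> rw [h]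
    · nlinarith [sq_nonneg (u.re - v.re), sq_nonneg (u.im - v.im)]
    · nlinarith [sq_nonneg (u.re + v.re), sq_nonneg (u.im + v.im)]
  have hc : -(s * (u.re * v.re + u.im * v.im)) ≤ |s| * |u.re * v.re + u.im * v.im| := by
    rw [← abs_mul]
    exact neg_le_abs _
  have hc' : -(|s| * |u.re * v.re + u.im * v.im|) ≤ s * (u.re * v.re + u.im * v.im) := by
    rw [← abs_mul]
    exact neg_abs_le _
  have hd : |s| * (2 * |u.re * v.re + u.im * v.im|) ≤ |s| * (‖u‖ ^ 2 + ‖v‖ ^ 2) := by gcongr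
  have hf : 0 ≤ k.im * ρ * (|s| * (‖u‖ ^ 2 + ‖v‖ ^ 2) +
      2 * (s * (u.re * v.re + u.im * v.im))) := by
    apply mul_nonneg (by positivity)
    linarith
  have := congrArg (2 * k.im * ·) him'
  nlinarith

/-- For `Re k > 0`, `Im k > 0` there are no nontrivial solutions without incoming waves. -/
theorem IsAdmissible.isUnit_add_sub_hop (h : IsAdmissible A B) {k : ℂ} (hre : 0 < k.re)
    (him : 0 < k.im) {a : I → ℝ} (ha : ∀ i, 0 < a i) :
    IsUnit ((A + (Complex.I * k) • B) +
      (A - (Complex.I * k) • B) * hop E (lineFactor k a)) := by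
  rw [← mulVec_injective_iff_isUnit, ← coe_mulVecLin, ← LinearMap.ker_eq_bot, LinearMap.ker_eq_bot']
  intro o ho
  rw [mulVecLin_apply, add_mulVec, ← mulVec_mulVec] at ho
  have hf := h.flux ho
  rw [Fintype.sum_sum_type, Fintype.sum_sum_type, ← Finset.sum_add_distrib] at hf
  simp only [hop_mulVec_inl, hop_mulVec_inr_inl, hop_mulVec_inr_inr, lineFactor] at hf
  choose c hc hle using fun i => line_flux_ge hre him (ha i)
  have h0 : ∑ e, k.re * ‖o (Sum.inl e)‖ ^ 2 + ∑ i, c i * (‖o (Sum.inr (Sum.inl i))‖ ^ 2 +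
      ‖o (Sum.inr (Sum.inr i))‖ ^ 2) ≤ 0 := by
    rw [← hf]
    apply add_le_add
    · simp
    · exact Finset.sum_le_sum fun i _ => hle i _ _
  have h1 : 0 ≤ ∑ e, k.re * ‖o (Sum.inl e)‖ ^ 2 := Finset.sum_nonneg fun _ _ => by positivity
  have h2 : 0 ≤ ∑ i, c i * (‖o (Sum.inr (Sum.inl i))‖ ^ 2 + ‖o (Sum.inr (Sum.inr i))‖ ^ 2) :=
    Finset.sum_nonneg fun i _ => mul_nonneg (hc i).le (by positivity)
  have h3 : ∑ e, k.re * ‖o (Sum.inl e)‖ ^ 2 = 0 := by linarith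
  have h4 : ∑ i, c i * (‖o (Sum.inr (Sum.inl i))‖ ^ 2 + ‖o (Sum.inr (Sum.inr i))‖ ^ 2) = 0 := by
    linarith
  rw [Finset.sum_eq_zero_iff_of_nonneg fun _ _ => by positivity] at h3
  rw [Finset.sum_eq_zero_iff_of_nonneg fun i _ => mul_nonneg (hc i).le (by positivity)] at h4
  have h5 : ∀ i, ‖o (Sum.inr (Sum.inl i))‖ ^ 2 + ‖o (Sum.inr (Sum.inr i))‖ ^ 2 = 0 := fun i =>
    (mul_eq_zero.1 (h4 i (Finset.mem_univ _))).resolve_left (hc i).ne'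
  ext x
  rcases x with e | i | i
  · simpa [hre.ne'] using h3 e (Finset.mem_univ _)
  · have : ‖o (Sum.inr (Sum.inl i))‖ ^ 2 = 0 := by
      nlinarith [h5 i, sq_nonneg ‖o (Sum.inr (Sum.inl i))‖, sq_nonneg ‖o (Sum.inr (Sum.inr i))‖]
    simpa using this
  · have : ‖o (Sum.inr (Sum.inr i))‖ ^ 2 = 0 := by
      nlinarith [h5 i, sq_nonneg ‖o (Sum.inr (Sum.inl i))‖, sq_nonneg ‖o (Sum.inr (Sum.inr i))‖]
    simpa using this

/-- For real `k` the scattering matrix of the boundary conditions is unitary. -/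
theorem IsAdmissible.mul_conjTranspose_eq_one (h : IsAdmissible A B) {k : ℝ} (hk : 0 < k)
    {M : Matrix (E ⊕ (I ⊕ I)) (E ⊕ (I ⊕ I)) ℂ}
    (hM : (A + (Complex.I * k) • B) * M = -(A - (Complex.I * k) • B)) : M * Mᴴ = 1 := by
  have hu := h.isUnit_add (k := k) (by simpa using hk)
  -- For real k the cross terms cancel, so (A ± ikB)(A ± ikB)† are both AA† + k²BB†.
  have h1 : (A + (Complex.I * k) • B) * (M * Mᴴ) * (A + (Complex.I * k) • B)ᴴ =
      (A + (Complex.I * k) • B) * (A + (Complex.I * k) • B)ᴴ := by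
    have : (A + (Complex.I * k) • B) * (M * Mᴴ) * (A + (Complex.I * k) • B)ᴴ =
        ((A + (Complex.I * k) • B) * M) * ((A + (Complex.I * k) • B) * M)ᴴ := by
      rw [conjTranspose_mul]
      simp only [Matrix.mul_assoc]
    rw [this, hM]
    have hc := h.mul_conjTranspose_eq
    simp only [conjTranspose_neg, conjTranspose_add, conjTranspose_sub, conjTranspose_smul,
      Matrix.neg_mul, Matrix.mul_neg, Matrix.add_mul, Matrix.mul_add, Matrix.sub_mul,
      Matrix.mul_sub, Matrix.smul_mul, Matrix.mul_smul, hc]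
    simp [smul_sub, smul_add]
    abel
  have hu' : IsUnit (A + (Complex.I * k) • B)ᴴ := hu.star
  rw [hu'.mul_left_inj] at h1
  conv_rhs at h1 => rw [← Matrix.mul_one (A + (Complex.I * k) • B)]
  rwa [hu.mul_right_inj] at h1

end Lagrangian

/-! ### Euclidean norm, solvability of linear systems, Neumann series. -/

section Norm

variable {n : Type*} [Fintype n]

/-- The Euclidean norm of a vector. -/
noncomputable def l2norm (x : n → ℂ) : ℝ := ‖(WithLp.toLp 2 x : EuclideanSpace ℂ n)‖

theorem l2norm_nonneg (x : n → ℂ) : 0 ≤ l2norm x := norm_nonneg _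

theorem l2norm_sq (x : n → ℂ) : l2norm x ^ 2 = ∑ i, ‖x i‖ ^ 2 :=
  EuclideanSpace.norm_sq_eq _

theorem l2norm_add_le (x y : n → ℂ) : l2norm (x + y) ≤ l2norm x + l2norm y := by
  rw [l2norm, WithLp.toLp_add]
  exact norm_add_le _ _

theorem l2norm_sub_le_abs (x y : n → ℂ) : l2norm x - l2norm y ≤ l2norm (x - y) := by
  rw [l2norm, l2norm, l2norm, WithLp.toLp_sub]
  exact norm_sub_norm_le _ _

theorem l2norm_smul (c : ℂ) (x : n → ℂ) : l2norm (c • x) = ‖c‖ * l2norm x := by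
  rw [l2norm, WithLp.toLp_smul, norm_smul, l2norm]

theorem norm_apply_le_l2norm (x : n → ℂ) (i : n) : ‖x i‖ ≤ l2norm x := by
  apply le_of_sq_le_sq _ (l2norm_nonneg x)
  rw [l2norm_sq]
  exact Finset.single_le_sum (f := fun i => ‖x i‖ ^ 2) (fun _ _ => by positivity)
    (Finset.mem_univ i)

theorem ofReal_l2norm_sq (x : n → ℂ) : ((l2norm x ^ 2 : ℝ) : ℂ) = star x ⬝ᵥ x := by
  rw [l2norm_sq, dotProduct, Complex.ofReal_sum]
  refine Finset.sum_congr rfl fun i _ => ?_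
  simp [← Complex.normSq_eq_conj_mul_self, Complex.normSq_eq_norm_sq]

open Matrix in
theorem l2norm_mulVec [DecidableEq n] {M : Matrix n n ℂ} (hM : Mᴴ * M = 1) (x : n → ℂ) :
    l2norm (M *ᵥ x) = l2norm x := by
  have : l2norm (M *ᵥ x) ^ 2 = l2norm x ^ 2 := by
    apply Complex.ofReal_injective
    rw [ofReal_l2norm_sq, ofReal_l2norm_sq, star_mulVec, ← dotProduct_mulVec, mulVec_mulVec, hM,
      one_mulVec]
  exact (pow_left_inj₀ (l2norm_nonneg _) (l2norm_nonneg _) two_ne_zero).1 this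

open Matrix in
-- Fredholm alternative: a vector outside the range is separated from it by a functional, whose
-- conjugated coefficients lie in the kernel of N†.
theorem exists_mulVec_eq [DecidableEq n] (N : Matrix n n ℂ) (c : n → ℂ)
    (h : ∀ y, Nᴴ *ᵥ y = 0 → star y ⬝ᵥ c = 0) : ∃ x, N *ᵥ x = c := by
  by_contra hc
  have hc' : c ∉ LinearMap.range N.mulVecLin := fun ⟨x, hx⟩ => hc ⟨x, hx⟩
  obtain ⟨f, hf, hle⟩ := Submodule.exists_le_ker_of_notMem hc'
  have hrep : ∀ x, f x = (fun i => f (Pi.single i 1)) ⬝ᵥ x := by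
    intro x
    rw [LinearMap.pi_apply_eq_sum_univ f x, dotProduct]
    exact Finset.sum_congr rfl fun i _ => by
      rw [smul_eq_mul, mul_comm]; congr; ext; simp [Pi.single_apply, eq_comm]
  apply hf
  rw [hrep]
  have := h (star fun i => f (Pi.single i 1)) ?_
  · rwa [star_star] at this
  · rw [← star_vecMul, star_eq_zero]
    ext j
    have h1 : f (N *ᵥ Pi.single j 1) = 0 := hle ⟨_, rfl⟩
    rw [hrep, dotProduct_mulVec] at h1
    simpa using h1

/-- Summing a Neumann series. -/
theorem one_sub_mul_tsum [DecidableEq n] {m : Type*} (R : Matrix n n ℂ) (Q : Matrix n m ℂ)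
    (h : ∀ x y, Summable fun N : ℕ => (R ^ N * Q) x y) :
    (1 - R) * Matrix.of (fun x y => ∑' N : ℕ, (R ^ N * Q) x y) = Q := by
  ext x y
  rw [Matrix.sub_mul, Matrix.one_mul, Matrix.sub_apply, Matrix.of_apply, sub_eq_iff_eq_add,
    (h x y).tsum_eq_zero_add, pow_zero, Matrix.one_mul]
  congr 1
  rw [Matrix.mul_apply]
  simp only [Matrix.of_apply]
  have h1 : ∀ z, R x z * ∑' N : ℕ, (R ^ N * Q) z y = ∑' N : ℕ, R x z * (R ^ N * Q) z y :=
    fun z => tsum_mul_left.symm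
  simp only [h1]
  rw [← Summable.tsum_finsetSum fun z _ => (h z y).mul_left _]
  refine tsum_congr fun N => ?_
  rw [pow_succ', Matrix.mul_assoc, Matrix.mul_apply]

theorem norm_pow_mul_apply_le [DecidableEq n] {m : Type*} {R : Matrix n n ℂ} {Q : Matrix n m ℂ}
    {δ C : ℝ} (hR : ∀ x y, ‖R x y‖ ≤ δ) (hQ : ∀ x y, ‖Q x y‖ ≤ C) (N : ℕ) (x : n) (y : m) :
    ‖(R ^ N * Q) x y‖ ≤ (Fintype.card n * δ) ^ N * C := by
  have hδ : 0 ≤ δ := (norm_nonneg _).trans (hR x x)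
  induction N generalizing x with
  | zero => simpa using hQ x y
  | succ N ih =>
    rw [pow_succ', Matrix.mul_assoc, Matrix.mul_apply]
    calc ‖∑ z, R x z * (R ^ N * Q) z y‖ ≤ ∑ z : n, δ * ((Fintype.card n * δ) ^ N * C) := by
          refine norm_sum_le_of_le _ fun z _ => ?_
          rw [norm_mul]
          exact mul_le_mul (hR x z) (ih z) (norm_nonneg _) hδ
      _ = _ := by
          rw [Finset.sum_const, Finset.card_univ, nsmul_eq_mul]
          ring

end Norm

/-! ### Real k: M unitary and unimodular line factors. -/

section Contraction

open Matrix

variable {E I : Type*} [Fintype E] [Fintype I] [DecidableEq E] [DecidableEq I]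
  {M : Matrix (E ⊕ (I ⊕ I)) (E ⊕ (I ⊕ I)) ℂ} {z : I → ℂ}

/-- `hop` permutes the internal ends up to phases and kills the external amplitudes, so what escapes
through the external lines is exactly the loss of norm. -/
theorem l2norm_hop_mulVec_sq (hz : ∀ i, ‖z i‖ = 1) (x : E ⊕ (I ⊕ I) → ℂ) :
    l2norm (hop E z *ᵥ x) ^ 2 + ∑ e, ‖x (Sum.inl e)‖ ^ 2 = l2norm x ^ 2 := by
  rw [l2norm_sq, l2norm_sq, Fintype.sum_sum_type, Fintype.sum_sum_type, Fintype.sum_sum_type,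
    Fintype.sum_sum_type]
  simp only [hop_mulVec_inl, hop_mulVec_inr_inl, hop_mulVec_inr_inr, norm_mul, hz]
  simp
  ring

theorem l2norm_mul_hop_mulVec_sq (hM : Mᴴ * M = 1) (hz : ∀ i, ‖z i‖ = 1) (x : E ⊕ (I ⊕ I) → ℂ) :
    l2norm ((M * hop E z) *ᵥ x) ^ 2 + ∑ e, ‖x (Sum.inl e)‖ ^ 2 = l2norm x ^ 2 := by
  rw [← mulVec_mulVec, l2norm_mulVec hM, l2norm_hop_mulVec_sq hz]

theorem l2norm_mul_hop_mulVec_le (hM : Mᴴ * M = 1) (hz : ∀ i, ‖z i‖ = 1)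
    (x : E ⊕ (I ⊕ I) → ℂ) : l2norm ((M * hop E z) *ᵥ x) ≤ l2norm x := by
  apply le_of_sq_le_sq _ (l2norm_nonneg x)
  rw [← l2norm_mul_hop_mulVec_sq hM hz x]
  have : 0 ≤ ∑ e, ‖x (Sum.inl e)‖ ^ 2 := Finset.sum_nonneg fun _ _ => by positivity
  linarith

theorem hop_conjTranspose (z : I → ℂ) : (hop E z)ᴴ = hop E (star z) := by
  rw [hop, fromBlocks_conjTranspose, fromBlocks_conjTranspose, hop]
  simp

/-- Solutions without incoming waves vanish on the external lines. -/
theorem apply_inl_eq_zero_of_mulVec_eq (hM : Mᴴ * M = 1) (hz : ∀ i, ‖z i‖ = 1)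
    {x : E ⊕ (I ⊕ I) → ℂ} (hx : (1 - M * hop E z) *ᵥ x = 0) (e : E) : x (Sum.inl e) = 0 := by
  rw [sub_mulVec, one_mulVec, sub_eq_zero] at hx
  have h1 := l2norm_mul_hop_mulVec_sq hM hz x
  rw [← hx, add_eq_left, Finset.sum_eq_zero_iff_of_nonneg fun _ _ => by positivity] at h1
  simpa using h1 e (Finset.mem_univ _)

theorem extIncl_mulVec_single_inl (e e' : E) :
    (extIncl E I *ᵥ Pi.single e' 1) (Sum.inl e) = Pi.single (M := fun _ => ℂ) e' 1 e := by
  simp [extIncl, Matrix.one_apply, Pi.single_apply]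

theorem extIncl_mulVec_single_inr (x : I ⊕ I) (e' : E) :
    (extIncl E I *ᵥ Pi.single e' 1) (Sum.inr x) = 0 := by
  simp [extIncl]

theorem l2norm_extIncl_mulVec_single (e : E) : l2norm (extIncl E I *ᵥ Pi.single e 1) = 1 := by
  have : l2norm (extIncl E I *ᵥ Pi.single e 1) ^ 2 = 1 := by
    rw [l2norm_sq, Fintype.sum_sum_type]
    simp only [extIncl_mulVec_single_inl, extIncl_mulVec_single_inr]
    simp [Pi.single_apply, apply_ite]
  exact (pow_eq_one_iff_of_nonneg (l2norm_nonneg _) two_ne_zero).1 this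

/-- The matrix 1 - M hop can be singular, because of waves trapped on the internal lines. If y is in
the kernel of its adjoint, then y = hop† M† y; comparing norms, M†y vanishes on the external lines,
so y is orthogonal to the right-hand side. -/
theorem exists_one_sub_mul_eq (hM : Mᴴ * M = 1) (hz : ∀ i, ‖z i‖ = 1) :
    ∃ O : Matrix (E ⊕ (I ⊕ I)) E ℂ, (1 - M * hop E z) * O = M * extIncl E I := by
  have key : ∀ e : E, ∃ x, (1 - M * hop E z) *ᵥ x = (M * extIncl E I) *ᵥ Pi.single e 1 := by
    intro e
    apply exists_mulVec_eq
    intro y hy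
    rw [conjTranspose_sub, conjTranspose_one, conjTranspose_mul, hop_conjTranspose, sub_mulVec,
      one_mulVec, sub_eq_zero, ← mulVec_mulVec] at hy
    have h1 := l2norm_hop_mulVec_sq (z := star z) (by simpa using hz) (Mᴴ *ᵥ y)
    rw [← hy, l2norm_mulVec (by rw [conjTranspose_conjTranspose]; exact mul_eq_one_comm.1 hM),
      add_eq_left, Finset.sum_eq_zero_iff_of_nonneg fun _ _ => by positivity] at h1
    have h2 : star y ᵥ* M = star (Mᴴ *ᵥ y) := by rw [star_mulVec, conjTranspose_conjTranspose]
    rw [← mulVec_mulVec, dotProduct_mulVec, h2, dotProduct, Fintype.sum_sum_type]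
    simp only [extIncl_mulVec_single_inr, mul_zero, Finset.sum_const_zero, add_zero]
    refine Finset.sum_eq_zero fun x _ => ?_
    have h3 : (Mᴴ *ᵥ y) (Sum.inl x) = 0 := by simpa using h1 x (Finset.mem_univ _)
    rw [Pi.star_apply, h3, star_zero, zero_mul]
  choose x hx using key
  refine ⟨Matrix.of fun h e => x e h, ?_⟩
  ext h e
  have := congrFun (hx e) h
  rw [mulVec_single_one] at this
  exact this

theorem eq_apply_of_one_sub_mul_eq (hM : Mᴴ * M = 1) (hz : ∀ i, ‖z i‖ = 1)
    {O O' : Matrix (E ⊕ (I ⊕ I)) E ℂ} (h : (1 - M * hop E z) * O = M * extIncl E I)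
    (h' : (1 - M * hop E z) * O' = M * extIncl E I) (e e' : E) :
    O (Sum.inl e) e' = O' (Sum.inl e) e' := by
  have h1 : (1 - M * hop E z) *ᵥ ((O - O').col e') = 0 := by
    have h2 : (1 - M * hop E z) * (O - O') = 0 := by rw [Matrix.mul_sub, h, h', sub_self]
    ext x
    exact congrFun (congrFun h2 x) e'
  exact sub_eq_zero.1 (apply_inl_eq_zero_of_mulVec_eq hM hz h1 e)

theorem hop_smul (r : ℂ) (z : I → ℂ) : hop E (r • z) = r • hop E z := by
  rw [hop, hop, fromBlocks_smul, fromBlocks_smul, ← diagonal_smul]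
  simp

theorem norm_pow_mul_extIncl_apply_le (hM : Mᴴ * M = 1) (hz : ∀ i, ‖z i‖ = 1) (N : ℕ)
    (x : E ⊕ (I ⊕ I)) (e : E) : ‖((M * hop E z) ^ N * (M * extIncl E I)) x e‖ ≤ 1 := by
  have h1 : l2norm (((M * hop E z) ^ N * (M * extIncl E I)) *ᵥ Pi.single e 1) ≤ 1 := by
    induction N with
    | zero =>
      rw [pow_zero, Matrix.one_mul, ← mulVec_mulVec, l2norm_mulVec hM,
        l2norm_extIncl_mulVec_single]
    | succ N ih =>
      rw [pow_succ', Matrix.mul_assoc, ← mulVec_mulVec]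
      exact (l2norm_mul_hop_mulVec_le hM hz _).trans ih
  have h2 := (norm_apply_le_l2norm _ x).trans h1
  rwa [mulVec_single_one] at h2

/-- Damping the propagation along the internal lines changes the scattering matrix by little. -/
theorem norm_sub_sq_le_of_damped (hM : Mᴴ * M = 1) (hz : ∀ i, ‖z i‖ = 1)
    {O O' : Matrix (E ⊕ (I ⊕ I)) E ℂ} (h : (1 - M * hop E z) * O = M * extIncl E I)
    {r : ℝ} (hr : 0 ≤ r) (hr1 : r < 1)
    (h' : (1 - M * hop E ((r : ℂ) • z)) * O' = M * extIncl E I) (e e' : E) :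
    ‖O' (Sum.inl e) e' - O (Sum.inl e) e'‖ ^ 2 ≤ 4 * (1 - r) * l2norm (O.col e') ^ 2 := by
  set W := M * hop E z with hW
  set o := O.col e'
  set y := (O' - O).col e' with hy
  rw [hop_smul, Matrix.mul_smul, ← hW] at h'
  -- The difference y of the two solutions is driven by a term of size 1 - r. As 1 - W may be
  -- singular, it cannot simply be inverted; only the contraction property of W is used.
  have h1 : (1 - W) *ᵥ y = -(((1 - r : ℝ) : ℂ) • (W *ᵥ (o + y))) := by
    have h2 : (1 - W) * (O' - O) = -(((1 - r : ℝ) : ℂ) • (W * O')) := by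
      rw [Matrix.mul_sub, h, ← h', Matrix.sub_mul, Matrix.sub_mul, Complex.ofReal_sub,
        Complex.ofReal_one, sub_smul, one_smul, Matrix.smul_mul]
      abel
    have h3 : o + y = O'.col e' := by
      ext x
      simp [o, hy]
    rw [h3]
    ext x
    exact congrFun (congrFun h2 x) e'
  have h2 : y = (r : ℂ) • (W *ᵥ y) + -(((1 - r : ℝ) : ℂ) • (W *ᵥ o)) := by
    rw [sub_mulVec, one_mulVec, sub_eq_iff_eq_add, mulVec_add] at h1
    conv_lhs => rw [h1]
    rw [Complex.ofReal_sub, Complex.ofReal_one, smul_add, sub_smul, sub_smul, one_smul, one_smul]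
    abel
  have hWle := l2norm_mul_hop_mulVec_le hM hz
  have hn : ∀ x : E ⊕ (I ⊕ I) → ℂ, l2norm (-(((1 - r : ℝ) : ℂ) • x)) = (1 - r) * l2norm x := by
    intro x
    rw [← neg_smul, l2norm_smul, norm_neg, Complex.norm_real, Real.norm_of_nonneg (by linarith)]
  have h3 : l2norm y ≤ l2norm o := by
    have h4 : l2norm y ≤ r * l2norm y + (1 - r) * l2norm o := by
      conv_lhs => rw [h2]
      refine (l2norm_add_le _ _).trans ?_
      rw [hn, l2norm_smul, Complex.norm_real, Real.norm_of_nonneg hr]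
      have := hWle y
      have := hWle o
      have : 0 ≤ 1 - r := by linarith
      gcongr
    have : (1 - r) * l2norm y ≤ (1 - r) * l2norm o := by linarith
    exact le_of_mul_le_mul_left this (by linarith)
  have h5 : l2norm y - l2norm (W *ᵥ y) ≤ (1 - r) * (2 * l2norm o) := by
    refine (l2norm_sub_le_abs _ _).trans ?_
    have : y - W *ᵥ y = (1 - W) *ᵥ y := by rw [sub_mulVec, one_mulVec]
    rw [this, h1, hn]
    have h6 := (hWle (o + y)).trans (l2norm_add_le _ _)
    have : 0 ≤ 1 - r := by linarith
    have h7 : l2norm (W *ᵥ (o + y)) ≤ 2 * l2norm o := by linarith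
    gcongr
  have h6 := l2norm_mul_hop_mulVec_sq hM hz y
  have h7 : ‖y (Sum.inl e)‖ ^ 2 ≤ ∑ e, ‖y (Sum.inl e)‖ ^ 2 :=
    Finset.single_le_sum (f := fun e => ‖y (Sum.inl e)‖ ^ 2) (fun _ _ => by positivity)
      (Finset.mem_univ e)
  have h8 : O' (Sum.inl e) e' - O (Sum.inl e) e' = y (Sum.inl e) := rfl
  rw [h8]
  refine h7.trans ?_
  have h9 := hWle y
  have h10 := l2norm_nonneg y
  have h11 := l2norm_nonneg (W *ᵥ y)
  have h12 := l2norm_nonneg o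
  -- The external part of y is ‖y‖² - ‖Wy‖². Its first factor is O(1 - r) and its second is bounded,
  -- although y itself need not be small.
  calc ∑ e, ‖y (Sum.inl e)‖ ^ 2 = (l2norm y - l2norm (W *ᵥ y)) * (l2norm y + l2norm (W *ᵥ y)) := by
        linear_combination h6
    _ ≤ ((1 - r) * (2 * l2norm o)) * (l2norm o + l2norm o) := by
        have : 0 ≤ 1 - r := by linarith
        gcongr
        linarith
    _ = _ := by ring

/-- The damped scattering matrix is bounded by one. -/
theorem norm_apply_le_one_of_damped (hM : Mᴴ * M = 1) (hz : ∀ i, ‖z i‖ = 1)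
    {O : Matrix (E ⊕ (I ⊕ I)) E ℂ} {r : ℝ} (hr : 0 ≤ r) (hr1 : r < 1)
    (h : (1 - M * hop E ((r : ℂ) • z)) * O = M * extIncl E I) (e e' : E) :
    ‖O (Sum.inl e) e'‖ ≤ 1 := by
  set o := O.col e' with ho
  have h1 : o = M *ᵥ (extIncl E I *ᵥ Pi.single e' 1 + (r : ℂ) • (hop E z *ᵥ o)) := by
    have h2 : O = M * (extIncl E I + (r : ℂ) • (hop E z * O)) := by
      rw [hop_smul, Matrix.sub_mul, Matrix.one_mul, sub_eq_iff_eq_add] at h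
      conv_lhs => rw [h]
      rw [Matrix.mul_add, Matrix.mul_assoc, Matrix.smul_mul]
    have h3 : o = O *ᵥ Pi.single e' 1 := by rw [mulVec_single_one]
    rw [h3]
    conv_lhs => rw [h2]
    rw [← mulVec_mulVec, add_mulVec, smul_mulVec, mulVec_mulVec]
  -- The incoming wave lives on the external ends and `hop` takes values on the internal ones, so
  -- Pythagoras applies. Combined with the exact norm loss of `hop`, the external part of ‖o‖² is 1
  -- - (1 - r²)‖hop o‖².
  have h2 : l2norm o ^ 2 = 1 + r ^ 2 * l2norm (hop E z *ᵥ o) ^ 2 := by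
    conv_lhs => rw [h1, l2norm_mulVec hM]
    have h3 : l2norm (extIncl E I *ᵥ Pi.single e' 1) ^ 2 = 1 := by
      rw [l2norm_extIncl_mulVec_single, one_pow]
    rw [← h3, l2norm_sq, l2norm_sq, l2norm_sq, Finset.mul_sum, ← Finset.sum_add_distrib]
    refine Finset.sum_congr rfl fun x _ => ?_
    rw [Pi.add_apply, Pi.smul_apply, smul_eq_mul]
    rcases x with x | x
    · rw [hop_mulVec_inl]
      simp
    · rw [extIncl_mulVec_single_inr]
      simp [mul_pow]
  have h3 := l2norm_hop_mulVec_sq hz o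
  have h4 : ‖o (Sum.inl e)‖ ^ 2 ≤ ∑ e, ‖o (Sum.inl e)‖ ^ 2 :=
    Finset.single_le_sum (f := fun e => ‖o (Sum.inl e)‖ ^ 2) (fun _ _ => by positivity)
      (Finset.mem_univ e)
  have h5 : 0 ≤ l2norm (hop E z *ᵥ o) ^ 2 := by positivity
  have h6 : 0 ≤ (1 - r ^ 2) * l2norm (hop E z *ᵥ o) ^ 2 :=
    mul_nonneg (by nlinarith) h5
  have h7 : ‖o (Sum.inl e)‖ ^ 2 ≤ 1 := by linarith
  exact (sq_le_one_iff₀ (norm_nonneg _)).1 h7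

end Contraction

/-! ### Matrix powers as sums over sequences of line ends. -/

section Paths

variable {E I : Type*}

/-- The internal line to which an end belongs. -/
def endLine : I ⊕ I → I := Sum.elim id id

/-- The ends through which a path leaving through the internal ends `h 0, h 1, …` and finally
through `x` leaves the vertices visited. -/
def pathOut {N : ℕ} (x : E ⊕ (I ⊕ I)) (h : Fin N → I ⊕ I) : Fin (N + 1) → E ⊕ (I ⊕ I) :=
  Fin.snoc (fun j => Sum.inr (h j)) x

/-- The ends through which a path that starts at `y` and leaves through the internal ends
`h 0, h 1, …` arrives at the vertices visited. -/
def pathIn {N : ℕ} (y : E ⊕ (I ⊕ I)) (h : Fin N → I ⊕ I) : Fin (N + 1) → E ⊕ (I ⊕ I) :=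
  Fin.cons y fun j => Sum.inr (h j).swap

@[simp]
theorem pathIn_zero {N : ℕ} (y : E ⊕ (I ⊕ I)) (h : Fin N → I ⊕ I) : pathIn y h 0 = y := rfl

@[simp]
theorem pathIn_succ {N : ℕ} (y : E ⊕ (I ⊕ I)) (h : Fin N → I ⊕ I) (j : Fin N) :
    pathIn y h j.succ = Sum.inr (h j).swap := rfl

@[simp]
theorem pathOut_last {N : ℕ} (x : E ⊕ (I ⊕ I)) (h : Fin N → I ⊕ I) :
    pathOut x h (Fin.last N) = x := Fin.snoc_last (α := fun _ => E ⊕ (I ⊕ I)) _ _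

@[simp]
theorem pathOut_castSucc {N : ℕ} (x : E ⊕ (I ⊕ I)) (h : Fin N → I ⊕ I) (j : Fin N) :
    pathOut x h j.castSucc = Sum.inr (h j) := Fin.snoc_castSucc (α := fun _ => E ⊕ (I ⊕ I)) _ _ _

theorem pathOut_cons_succ {N : ℕ} (x : E ⊕ (I ⊕ I)) (h₀ : I ⊕ I) (h : Fin N → I ⊕ I)
    (j : Fin (N + 1)) : pathOut x (Fin.cons h₀ h : Fin (N + 1) → I ⊕ I) j.succ = pathOut x h j := by
  refine Fin.lastCases ?_ (fun j => ?_) j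
  · rw [Fin.succ_last, pathOut_last, pathOut_last]
  · rw [Fin.succ_castSucc, pathOut_castSucc, pathOut_castSucc, Fin.cons_succ]

theorem pathIn_cons_succ {N : ℕ} (y : E ⊕ (I ⊕ I)) (h₀ : I ⊕ I) (h : Fin N → I ⊕ I)
    (j : Fin (N + 1)) :
    pathIn y (Fin.cons h₀ h : Fin (N + 1) → I ⊕ I) j.succ = pathIn (Sum.inr h₀.swap) h j := by
  refine Fin.cases ?_ (fun j => ?_) j
  · rw [pathIn_succ, Fin.cons_zero, pathIn_zero]
  · rw [pathIn_succ, Fin.cons_succ, pathIn_succ]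

variable [Fintype E] [Fintype I] [DecidableEq E] [DecidableEq I]

theorem mul_hop_mul_apply {m n : Type*} (P : Matrix m (E ⊕ (I ⊕ I)) ℂ)
    (Q : Matrix (E ⊕ (I ⊕ I)) n ℂ) (z : I → ℂ) (x : m) (y : n) :
    (P * (hop E z * Q)) x y =
      ∑ h : I ⊕ I, P x (Sum.inr h.swap) * (z (endLine h) * Q (Sum.inr h) y) := by
  have h1 : ∀ h, (hop E z * Q) h y = (hop E z).mulVec (fun h' => Q h' y) h := fun h => rfl
  rw [Matrix.mul_apply, Fintype.sum_sum_type, Fintype.sum_sum_type, Fintype.sum_sum_type]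
  simp only [h1, hop_mulVec_inl, hop_mulVec_inr_inl, hop_mulVec_inr_inr]
  simp [endLine]
  ring

theorem pow_mul_apply (M : Matrix (E ⊕ (I ⊕ I)) (E ⊕ (I ⊕ I)) ℂ) (z : I → ℂ) (N : ℕ)
    (x y : E ⊕ (I ⊕ I)) :
    ((M * hop E z) ^ N * M) x y = ∑ h : Fin N → I ⊕ I,
      (∏ j, M (pathOut x h j) (pathIn y h j)) * ∏ j, z (endLine (h j)) := by
  induction N generalizing y with
  | zero =>
    simp only [pow_zero, Matrix.one_mul, Fintype.sum_unique, Fin.prod_univ_zero, mul_one]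
    rw [Fin.prod_univ_one]
    rfl
  | succ N ih =>
    -- The rightmost factors form the first step of the path. Splitting it off moves the starting
    -- end to `h₀.swap`, the far end of the line taken, which is why the induction needs arbitrary
    -- y.
    have h1 : (M * hop E z) ^ (N + 1) * M = ((M * hop E z) ^ N * M) * (hop E z * M) := by
      rw [pow_succ]
      simp only [Matrix.mul_assoc]
    rw [h1, mul_hop_mul_apply, ← (Fin.consEquiv fun _ => I ⊕ I).sum_comp, Fintype.sum_prod_type]
    refine Finset.sum_congr rfl fun h₀ _ => ?_
    rw [ih, Finset.sum_mul]
    refine Finset.sum_congr rfl fun (h : Fin N → I ⊕ I) _ => ?_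
    have h2 : (Fin.consEquiv fun _ => I ⊕ I) (h₀, h) = (Fin.cons h₀ h : Fin (N + 1) → I ⊕ I) := rfl
    have h3 : pathOut x (Fin.cons h₀ h : Fin (N + 1) → I ⊕ I) 0 = Sum.inr h₀ := by
      rw [← Fin.castSucc_zero, pathOut_castSucc, Fin.cons_zero]
    have h4 : ∏ j, M (pathOut x (Fin.cons h₀ h : Fin (N + 1) → I ⊕ I) j)
        (pathIn y (Fin.cons h₀ h : Fin (N + 1) → I ⊕ I) j) =
          M (Sum.inr h₀) y * ∏ j, M (pathOut x h j) (pathIn (Sum.inr h₀.swap) h j) := by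
      rw [Fin.prod_univ_succ]
      simp only [pathOut_cons_succ, pathIn_cons_succ, h3, pathIn_zero]
    have h5 : ∏ j, z (endLine ((Fin.cons h₀ h : Fin (N + 1) → I ⊕ I) j)) =
        z (endLine h₀) * ∏ j, z (endLine (h j)) := by
      rw [Fin.prod_univ_succ]
      simp only [Fin.cons_zero, Fin.cons_succ]
    rw [h2, h4, h5]
    ring

end Paths

/-! ### Walks as compatible sequences of line ends. -/

section Routes

variable {V E I : Type*} [DecidableEq V]

/-- The walks with `N` steps from `e'` to `e`, encoded by the ends through which they leave the
vertices visited. -/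
abbrev Route (G : LineGraph V E I) (e' e : E) (N : ℕ) : Type _ :=
  {h : Fin N → I ⊕ I //
    ∀ j, G.vert (pathOut (Sum.inl e) h j) = G.vert (pathIn (Sum.inl e') h j)}

variable (G : LineGraph V E I) {e' e : E}

theorem incident_vert_inr (h : I ⊕ I) : G.Incident (G.vert (Sum.inr h)) (endLine h) := by
  rcases h with i | i
  · exact Or.inl rfl
  · exact Or.inr rfl

theorem incident_vert_inr_swap (h : I ⊕ I) :
    G.Incident (G.vert (Sum.inr h.swap)) (endLine h) := by
  rcases h with i | i
  · exact Or.inr rfl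
  · exact Or.inl rfl

theorem vert_inr_ne_vert_inr_swap (h : I ⊕ I) :
    G.vert (Sum.inr h) ≠ G.vert (Sum.inr h.swap) := by
  rcases h with i | i
  · exact G.no_tadpole i
  · exact (G.no_tadpole i).symm

theorem lineEnd_endLine (h : I ⊕ I) :
    G.lineEnd (endLine h) (G.vert (Sum.inr h)) = Sum.inr h := by
  rcases h with i | i
  · exact if_pos rfl
  · exact if_neg (G.no_tadpole i).symm

theorem lineEnd_endLine_swap (h : I ⊕ I) :
    G.lineEnd (endLine h) (G.vert (Sum.inr h.swap)) = Sum.inr h.swap := by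
  rcases h with i | i
  · exact if_neg (G.no_tadpole i).symm
  · exact if_pos rfl

variable {G} {N : ℕ}

theorem Route.vert_pathIn_castSucc (r : G.Route e' e N) (j : Fin N) :
    G.vert (pathIn (Sum.inl e') r.1 j.castSucc) = G.vert (Sum.inr (r.1 j)) := by
  rw [← r.2, pathOut_castSucc]

/-- The walk described by a route. -/
def Route.toWalk (r : G.Route e' e N) : G.Walk e' e where
  length := N
  edge j := endLine (r.1 j)
  vertex j := G.vert (pathIn (Sum.inl e') r.1 j)
  start := rfl
  finish := by rw [← r.2, pathOut_last]; rfl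
  incident_left j := by
    rw [r.vert_pathIn_castSucc]
    exact G.incident_vert_inr _
  incident_right j := G.incident_vert_inr_swap _
  ne j := by
    rw [r.vert_pathIn_castSucc]
    exact G.vert_inr_ne_vert_inr_swap _

theorem Route.toWalk_outgoing (r : G.Route e' e N) :
    r.toWalk.outgoing = pathOut (Sum.inl e) r.1 := by
  rw [Walk.outgoing, pathOut]
  congr 1
  funext j
  refine Eq.trans ?_ (G.lineEnd_endLine (r.1 j))
  exact congrArg (G.lineEnd _) (r.vert_pathIn_castSucc j)

theorem Route.toWalk_incoming (r : G.Route e' e N) :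
    r.toWalk.incoming = pathIn (Sum.inl e') r.1 := by
  rw [Walk.incoming, pathIn]
  congr 1
  funext j
  exact G.lineEnd_endLine_swap (r.1 j)

theorem Route.toWalk_injective :
    Function.Injective fun r : Σ N, G.Route e' e N => r.2.toWalk := by
  rintro ⟨N, r⟩ ⟨N', r'⟩ h
  simp only at h
  have hN : N = N' := congrArg Walk.length h
  subst hN
  have h1 : pathOut (Sum.inl e) r.1 = pathOut (Sum.inl e) r'.1 := by
    have h2 : HEq r.toWalk.outgoing r'.toWalk.outgoing := by rw [h]
    rw [r.toWalk_outgoing, r'.toWalk_outgoing] at h2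
    exact eq_of_heq h2
  have h2 : r = r' := by
    ext j : 2
    have := congrFun h1 j.castSucc
    rw [pathOut_castSucc, pathOut_castSucc] at this
    exact Sum.inr_injective this
  rw [h2]

/-- The vertex before a step and the line taken determine the end of departure. Since the next
vertex is incident with the line and different, it sits at the opposite end. -/
theorem Route.toWalk_surjective :
    Function.Surjective fun r : Σ N, G.Route e' e N => r.2.toWalk := by
  rintro ⟨N, edge, vertex, start, finish, hl, hr, ne⟩
  let h : Fin N → I ⊕ I := fun j =>
    if vertex j.castSucc = G.init (edge j) then Sum.inl (edge j) else Sum.inr (edge j)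
  have h1 : ∀ j, endLine (h j) = edge j := by
    intro j
    simp only [h]
    split_ifs <;> rfl
  have h2 : ∀ j, G.vert (Sum.inr (h j)) = vertex j.castSucc := by
    intro j
    simp only [h]
    split_ifs with hj
    · exact hj.symm
    · exact ((hl j).resolve_left hj).symm
  have h3 : ∀ j, G.vert (Sum.inr (h j).swap) = vertex j.succ := by
    intro j
    simp only [h]
    split_ifs with hj
    · exact ((hr j).resolve_left fun h' => ne j (hj.trans h'.symm)).symm
    · exact ((hr j).resolve_right fun h' => ne j (((hl j).resolve_left hj).trans h'.symm)).symm
  have h4 : ∀ j, G.vert (pathIn (Sum.inl e') h j) = vertex j := by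
    intro j
    refine Fin.cases ?_ (fun j => ?_) j
    · exact start.symm
    · exact h3 j
  refine ⟨⟨N, h, fun j => ?_⟩, ?_⟩
  · rw [h4]
    refine Fin.lastCases ?_ (fun j => ?_) j
    · rw [pathOut_last]
      exact finish.symm
    · rw [pathOut_castSucc, h2]
  · exact (Walk.mk.injEq ..).mpr ⟨rfl, heq_of_eq (funext h1), heq_of_eq (funext h4)⟩

/-- Routes of arbitrary length are the same as walks. -/
noncomputable def routeEquiv (G : LineGraph V E I) (e' e : E) :
    (Σ N, G.Route e' e N) ≃ G.Walk e' e :=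
  Equiv.ofBijective (fun r => r.2.toWalk) ⟨Route.toWalk_injective, Route.toWalk_surjective⟩

/-- The weight of a walk for a matrix `M` of transition amplitudes. -/
noncomputable def Walk.amplitude (M : Matrix (E ⊕ (I ⊕ I)) (E ⊕ (I ⊕ I)) ℂ) (w : G.Walk e' e) :
    ℂ :=
  ∏ j, M (w.outgoing j) (w.incoming j)

theorem Route.amplitude_toWalk (M : Matrix (E ⊕ (I ⊕ I)) (E ⊕ (I ⊕ I)) ℂ)
    (r : G.Route e' e N) : r.toWalk.amplitude M =
      ∏ j, M (pathOut (Sum.inl e) r.1 j) (pathIn (Sum.inl e') r.1 j) := by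
  rw [Walk.amplitude, r.toWalk_outgoing, r.toWalk_incoming]
  rfl

variable [DecidableEq I]

theorem Route.score_toWalk_apply (r : G.Route e' e N) (i : I) :
    r.toWalk.score i = (Finset.univ.filter fun j => endLine (r.1 j) = i).card := rfl

variable [Fintype I]

theorem Route.sum_score_toWalk (r : G.Route e' e N) : ∑ i, r.toWalk.score i = N := by
  simp only [r.score_toWalk_apply]
  rw [← Finset.card_eq_sum_card_fiberwise (fun _ _ => Finset.mem_univ _), Finset.card_univ,
    Fintype.card_fin]

theorem Route.prod_pow_score_toWalk (r : G.Route e' e N) (z : I → ℂ) :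
    ∏ i, z i ^ r.toWalk.score i = ∏ j, z (endLine (r.1 j)) := by
  simp only [r.score_toWalk_apply]
  rw [← Finset.prod_fiberwise' Finset.univ (fun j => endLine (r.1 j))]
  exact Finset.prod_congr rfl fun i _ => (Finset.prod_const _).symm

variable [Fintype E] [DecidableEq E]

/-- The powers in the Neumann series are sums over walks. -/
theorem pow_mul_apply_inl_inl {M : Matrix (E ⊕ (I ⊕ I)) (E ⊕ (I ⊕ I)) ℂ}
    (hM : ∀ x y, G.vert x ≠ G.vert y → M x y = 0) (z : I → ℂ) (N : ℕ) (e e' : E) :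
    ((M * hop E z) ^ N * M) (Sum.inl e) (Sum.inl e') =
      ∑ r : G.Route e' e N, r.toWalk.amplitude M * ∏ i, z i ^ r.toWalk.score i := by
  rw [pow_mul_apply]
  simp only [Route.prod_pow_score_toWalk, Route.amplitude_toWalk]
  rw [← Finset.sum_subtype (Finset.univ.filter fun h : Fin N → I ⊕ I =>
      ∀ j, G.vert (pathOut (Sum.inl e) h j) = G.vert (pathIn (Sum.inl e') h j))
    (fun h => by rw [Finset.mem_filter, and_iff_right (Finset.mem_univ h)])
    (fun h => (∏ j, M (pathOut (Sum.inl e) h j) (pathIn (Sum.inl e') h j)) *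
      ∏ j, z (endLine (h j)))]
  symm
  -- A sequence that leaves some vertex through an end sitting elsewhere contains a vanishing factor
  -- of M.
  refine Finset.sum_filter_of_ne fun h _ hne j => ?_
  by_contra hj
  exact hne (by rw [Finset.prod_eq_zero (Finset.mem_univ j) (hM _ _ hj), zero_mul])

/-- The score determines the number of steps, N = ∑ n_i, so only routes of this one length
contribute, and these form a finite type. -/
theorem walkCoeff_eq_sum (Av Bv : ∀ v, Matrix (G.Star v) (G.Star v) ℂ) (k : ℂ) (n : I → ℕ)
    (e e' : E) : G.walkCoeff Av Bv k n e e' = ∑ r : G.Route e' e (∑ i, n i),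
      if r.toWalk.score = n then
        r.toWalk.amplitude (G.starSum (G.vertexScattering Av Bv k)) else 0 := by
  have h1 : G.walkCoeff Av Bv k n e e' = ∑ᶠ (r : G.Route e' e (∑ i, n i))
      (_ : r ∈ {r : G.Route e' e (∑ i, n i) | r.toWalk.score = n}),
        r.toWalk.amplitude (G.starSum (G.vertexScattering Av Bv k)) := by
    symm
    refine finsum_mem_eq_of_bijOn (s := {r : G.Route e' e (∑ i, n i) | r.toWalk.score = n})
      (t := {w | w.score = n})
      (f := fun r => r.toWalk.amplitude (G.starSum (G.vertexScattering Av Bv k)))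
      (g := fun w => w.weight Av Bv k) (fun r => r.toWalk) ⟨?_, ?_, ?_⟩ ?_
    · exact fun r hr => hr
    · intro r _ r' _ h
      have := @Route.toWalk_injective _ _ _ _ G e' e ⟨_, r⟩ ⟨_, r'⟩ h
      exact eq_of_heq (Sigma.mk.inj this).2
    · intro w hw
      obtain ⟨⟨N, r⟩, rfl⟩ := Route.toWalk_surjective w
      have hN : ∑ i, n i = N := by
        rw [← r.sum_score_toWalk]
        exact congrArg (fun n : I → ℕ => ∑ i, n i) hw.symm
      subst hN
      exact ⟨r, hw, rfl⟩
    · exact fun _ _ => rfl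
  rw [h1, ← Finset.sum_filter, finsum_mem_eq_finite_toFinset_sum _ (Set.toFinite _)]
  exact Finset.sum_congr (by ext; simp) fun _ _ => rfl

end Routes

/-! ### From vertex boundary conditions to the global matrix M. -/

section StarSum

variable {V E I : Type*} [Fintype V] [Fintype E] [Fintype I] [DecidableEq V] [DecidableEq E]
  [DecidableEq I] (G : LineGraph V E I)

theorem starSum_apply (D : ∀ v, Matrix (G.Star v) (G.Star v) ℂ) (x y : E ⊕ (I ⊕ I)) :
    G.starSum D x y =
      if p : G.vert y = G.vert x then D (G.vert x) ⟨x, rfl⟩ ⟨y, p⟩ else 0 := rfl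

theorem starSum_apply_eq_zero (D : ∀ v, Matrix (G.Star v) (G.Star v) ℂ) {x y : E ⊕ (I ⊕ I)}
    (h : G.vert x ≠ G.vert y) : G.starSum D x y = 0 :=
  dif_neg (Ne.symm h)

theorem starSum_eq_submatrix (D : ∀ v, Matrix (G.Star v) (G.Star v) ℂ) :
    G.starSum D = (Matrix.blockDiagonal' D).submatrix (Equiv.sigmaFiberEquiv G.vert).symm
      (Equiv.sigmaFiberEquiv G.vert).symm := by
  ext x y
  have hx : (Equiv.sigmaFiberEquiv G.vert).symm x = ⟨G.vert x, ⟨x, rfl⟩⟩ := rfl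
  rw [Matrix.submatrix_apply, hx]
  by_cases p : G.vert y = G.vert x
  · have hy : (Equiv.sigmaFiberEquiv G.vert).symm y = ⟨G.vert x, ⟨y, p⟩⟩ := by
      rw [Equiv.symm_apply_eq]
      rfl
    rw [hy, Matrix.blockDiagonal'_apply_eq, starSum_apply, dif_pos p]
  · rw [starSum_apply, dif_neg p]
    exact (Matrix.blockDiagonal'_apply_ne D _ _ (Ne.symm p)).symm

theorem starSum_mul (D D' : ∀ v, Matrix (G.Star v) (G.Star v) ℂ) :
    G.starSum (fun v => D v * D' v) = G.starSum D * G.starSum D' := by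
  rw [starSum_eq_submatrix, starSum_eq_submatrix, starSum_eq_submatrix,
    Matrix.submatrix_mul_equiv, Matrix.blockDiagonal'_mul]

/-- The diagonal block at v of the inverse is a right inverse of D(v). -/
theorem isUnit_det_of_isUnit_starSum {D : ∀ v, Matrix (G.Star v) (G.Star v) ℂ}
    (h : IsUnit (G.starSum D)) (v : V) : IsUnit (D v).det := by
  rw [Matrix.isUnit_iff_isUnit_det, starSum_eq_submatrix, Matrix.det_submatrix_equiv_self] at h
  have h1 := Matrix.mul_nonsing_inv _ h
  have h2 : D v * Matrix.blockDiag' (Matrix.blockDiagonal' D)⁻¹ v = 1 := by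
    ext x y
    have h3 := congrFun (congrFun h1 ⟨v, x⟩) ⟨v, y⟩
    rw [Matrix.mul_apply, Fintype.sum_sigma, Finset.sum_eq_single v] at h3
    · simp only [Matrix.blockDiagonal'_apply_eq] at h3
      rw [Matrix.mul_apply, Matrix.one_apply]
      refine h3.trans ?_
      rw [Matrix.one_apply]
      simp
    · intro w _ hw
      exact Finset.sum_eq_zero fun u _ => by
        rw [Matrix.blockDiagonal'_apply_ne D _ _ hw.symm, zero_mul]
    · exact fun hv => absurd (Finset.mem_univ v) hv
  exact (Matrix.isUnit_iff_isUnit_det _).1 (IsUnit.of_mul_eq_one _ h2)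

theorem IsLocalWith.isUnit_det {A B : Matrix (E ⊕ (I ⊕ I)) (E ⊕ (I ⊕ I)) ℂ}
    (hAB : IsAdmissible A B) {Av Bv : ∀ v, Matrix (G.Star v) (G.Star v) ℂ}
    (hloc : G.IsLocalWith A B Av Bv) {k : ℂ} (hk : 0 < k.re) (v : V) :
    IsUnit (Av v + (Complex.I * k) • Bv v).det := by
  obtain ⟨C, hC, hA, hB⟩ := hloc
  refine G.isUnit_det_of_isUnit_starSum (D := fun v => Av v + (Complex.I * k) • Bv v) ?_ v
  have : G.starSum (fun v => Av v + (Complex.I * k) • Bv v) = C * (A + (Complex.I * k) • B) := by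
    rw [Matrix.mul_add, Matrix.mul_smul, hA, hB]
    ext x y
    simp only [starSum_apply, Matrix.add_apply, Matrix.smul_apply]
    split_ifs <;> simp
  rw [this]
  exact hC.mul (hAB.isUnit_add hk)

/-- Identifies M with the direct sum of the vertex scattering matrices; the invertible C multiplies
both sides from the left and cancels. -/
theorem IsLocalWith.mul_starSum_vertexScattering {A B : Matrix (E ⊕ (I ⊕ I)) (E ⊕ (I ⊕ I)) ℂ}
    (hAB : IsAdmissible A B) {Av Bv : ∀ v, Matrix (G.Star v) (G.Star v) ℂ}
    (hloc : G.IsLocalWith A B Av Bv) {k : ℂ} (hk : 0 < k.re) :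
    (A + (Complex.I * k) • B) * G.starSum (G.vertexScattering Av Bv k) =
      -(A - (Complex.I * k) • B) := by
  have hu := fun v => hloc.isUnit_det G hAB hk v
  obtain ⟨C, hC, hA, hB⟩ := hloc
  have h1 : G.starSum (fun v => Av v + (Complex.I * k) • Bv v) =
      C * (A + (Complex.I * k) • B) := by
    rw [Matrix.mul_add, Matrix.mul_smul, hA, hB]
    ext x y
    simp only [starSum_apply, Matrix.add_apply, Matrix.smul_apply]
    split_ifs <;> simp
  have h2 : G.starSum (fun v => -(Av v - (Complex.I * k) • Bv v)) =
      C * -(A - (Complex.I * k) • B) := by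
    rw [Matrix.mul_neg, Matrix.mul_sub, Matrix.mul_smul, hA, hB]
    ext x y
    simp only [starSum_apply, Matrix.sub_apply, Matrix.neg_apply, Matrix.smul_apply]
    split_ifs <;> simp
  rw [← hC.mul_right_inj, ← Matrix.mul_assoc, ← h1, ← starSum_mul, ← h2]
  congr 1
  funext v
  rw [vertexScattering, Matrix.mul_neg, ← Matrix.mul_assoc, Matrix.mul_nonsing_inv _ (hu v),
    Matrix.one_mul]

end StarSum

/-! ### Abel summation and the Fourier coefficients for k > 0. -/

section Fourier

open MeasureTheory Filter Topology Matrix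

variable {E I : Type*} [Fintype E] [Fintype I] [DecidableEq E] [DecidableEq I]

theorem norm_lineFactor_ofReal (k : ℝ) (b : I → ℝ) (i : I) : ‖lineFactor (k : ℂ) b i‖ = 1 := by
  rw [lineFactor, Complex.norm_exp]
  simp

theorem mul_extIncl_apply {m : Type*} (P : Matrix m (E ⊕ (I ⊕ I)) ℂ) (x : m) (e : E) :
    (P * extIncl E I) x e = P x (Sum.inl e) := by
  simp [Matrix.mul_apply, extIncl, Matrix.one_apply]

theorem pow_mul_hop_smul_apply (M : Matrix (E ⊕ (I ⊕ I)) (E ⊕ (I ⊕ I)) ℂ) (z : I → ℂ) (r : ℂ)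
    (N : ℕ) (x : E ⊕ (I ⊕ I)) (e : E) :
    ((M * hop E (r • z)) ^ N * (M * extIncl E I)) x e =
      r ^ N * ((M * hop E z) ^ N * M) x (Sum.inl e) := by
  rw [hop_smul, Matrix.mul_smul, smul_pow, Matrix.smul_mul, Matrix.smul_apply, smul_eq_mul,
    ← Matrix.mul_assoc, mul_extIncl_apply]

/-- The scattering amplitude damped by a factor `r` per step. -/
noncomputable def damped (M : Matrix (E ⊕ (I ⊕ I)) (E ⊕ (I ⊕ I)) ℂ) (z : I → ℂ) (r : ℝ)
    (e e' : E) : ℂ :=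
  ∑' N : ℕ, (r : ℂ) ^ N * ((M * hop E z) ^ N * M) (Sum.inl e) (Sum.inl e')

variable {M : Matrix (E ⊕ (I ⊕ I)) (E ⊕ (I ⊕ I)) ℂ} {z : I → ℂ}

theorem norm_pow_mul_apply_inl_le (hM : Mᴴ * M = 1) (hz : ∀ i, ‖z i‖ = 1) {r : ℝ} (hr : 0 ≤ r)
    (N : ℕ) (x : E ⊕ (I ⊕ I)) (e : E) :
    ‖(r : ℂ) ^ N * ((M * hop E z) ^ N * M) x (Sum.inl e)‖ ≤ r ^ N := by
  have := norm_pow_mul_extIncl_apply_le hM hz N x e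
  rw [← Matrix.mul_assoc, mul_extIncl_apply] at this
  rw [norm_mul, norm_pow, Complex.norm_real, Real.norm_of_nonneg hr]
  exact mul_le_of_le_one_right (by positivity) this

/-- A factor r per step amounts to replacing z by rz, so the Abel sum consists of the external rows
of a solution of the damped system, to which the estimates for damped solutions apply. -/
theorem exists_damped_eq (hM : Mᴴ * M = 1) (hz : ∀ i, ‖z i‖ = 1) {r : ℝ} (hr : 0 ≤ r)
    (hr1 : r < 1) : ∃ O : Matrix (E ⊕ (I ⊕ I)) E ℂ,
      (1 - M * hop E ((r : ℂ) • z)) * O = M * extIncl E I ∧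
        ∀ e e', O (Sum.inl e) e' = damped M z r e e' := by
  refine ⟨_, one_sub_mul_tsum _ _ fun x e => ?_, fun e e' => ?_⟩
  · simp only [pow_mul_hop_smul_apply]
    exact Summable.of_norm_bounded (summable_geometric_of_lt_one hr hr1)
      fun N => norm_pow_mul_apply_inl_le hM hz hr N x e
  · simp only [pow_mul_hop_smul_apply, Matrix.of_apply]
    rfl

theorem norm_damped_le_one (hM : Mᴴ * M = 1) (hz : ∀ i, ‖z i‖ = 1) {r : ℝ} (hr : 0 ≤ r)
    (hr1 : r < 1) (e e' : E) : ‖damped M z r e e'‖ ≤ 1 := by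
  obtain ⟨O, hO, h⟩ := exists_damped_eq hM hz hr hr1
  rw [← h]
  exact norm_apply_le_one_of_damped hM hz hr hr1 hO e e'

/-- The rate √(1 - r) carries the norm of the undamped solution, for which no bound uniform in z is
given. Uniformity is supplied by `norm_damped_le_one` instead. -/
theorem tendsto_damped (hM : Mᴴ * M = 1) (hz : ∀ i, ‖z i‖ = 1) {O : Matrix (E ⊕ (I ⊕ I)) E ℂ}
    (hO : (1 - M * hop E z) * O = M * extIncl E I) (e e' : E) :
    Tendsto (fun r : ℝ => damped M z r e e') (𝓝[<] 1) (𝓝 (O (Sum.inl e) e')) := by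
  rw [tendsto_iff_norm_sub_tendsto_zero]
  have h1 : Tendsto (fun r : ℝ => Real.sqrt (4 * (1 - r) * l2norm (O.col e') ^ 2)) (𝓝[<] 1)
      (𝓝 0) := by
    have : Continuous fun r : ℝ => Real.sqrt (4 * (1 - r) * l2norm (O.col e') ^ 2) := by fun_prop
    have h2 := (this.tendsto 1).mono_left (nhdsWithin_le_nhds (s := Set.Iio 1))
    simpa using h2
  refine squeeze_zero' (Eventually.of_forall fun _ => norm_nonneg _) ?_ h1
  filter_upwards [Ioo_mem_nhdsLT (zero_lt_one' ℝ)] with r hr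
  obtain ⟨O', hO', h⟩ := exists_damped_eq hM hz hr.1.le hr.2
  rw [← h]
  exact Real.le_sqrt_of_sq_le (norm_sub_sq_le_of_damped hM hz hO hr.1.le hr.2 hO' e e')

/-- Only S is unique: interior amplitudes may differ by trapped waves, which do not reach the
external lines. -/
theorem existsUnique_isScatteringMatrix_ofReal {A B : Matrix (E ⊕ (I ⊕ I)) (E ⊕ (I ⊕ I)) ℂ}
    (hAB : IsAdmissible A B) {k : ℝ} (hk : 0 < k) (b : I → ℝ)
    (hM : (A + (Complex.I * k) • B) * M = -(A - (Complex.I * k) • B)) :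
    ∃! S, IsScatteringMatrix A B (k : ℂ) b S := by
  have hu := hAB.isUnit_add (k := k) (by simpa using hk)
  have hM' := mul_eq_one_comm.1 (hAB.mul_conjTranspose_eq_one hk hM)
  obtain ⟨O, hO⟩ := exists_one_sub_mul_eq (E := E) hM' (norm_lineFactor_ofReal k b)
  refine ⟨O.toRows₁, (isScatteringMatrix_iff' hu hM b _).2 ⟨O, rfl, hO⟩, fun S hS => ?_⟩
  obtain ⟨O', rfl, hO'⟩ := (isScatteringMatrix_iff' hu hM b _).1 hS
  ext e e'
  exact eq_apply_of_one_sub_mul_eq hM' (norm_lineFactor_ofReal k b) hO' hO e e'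

theorem tendsto_damped_scatteringMatrix {A B : Matrix (E ⊕ (I ⊕ I)) (E ⊕ (I ⊕ I)) ℂ}
    (hAB : IsAdmissible A B) {k : ℝ} (hk : 0 < k) (b : I → ℝ)
    (hM : (A + (Complex.I * k) • B) * M = -(A - (Complex.I * k) • B)) (e e' : E) :
    Tendsto (fun r : ℝ => damped M (lineFactor k b) r e e') (𝓝[<] 1)
      (𝓝 (scatteringMatrix A B (k : ℂ) b e e')) := by
  have hu := hAB.isUnit_add (k := k) (by simpa using hk)
  have hM' := mul_eq_one_comm.1 (hAB.mul_conjTranspose_eq_one hk hM)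
  have h1 : IsScatteringMatrix A B (k : ℂ) b (scatteringMatrix A B (k : ℂ) b) :=
    Classical.epsilon_spec (existsUnique_isScatteringMatrix_ofReal hAB hk b hM).exists
  obtain ⟨O, hO, h⟩ := (isScatteringMatrix_iff' hu hM b _).1 h1
  rw [← hO]
  exact tendsto_damped hM' (norm_lineFactor_ofReal k b) h e e'

theorem integral_exp_mul_int {k : ℝ} (hk : 0 < k) (m : ℤ) :
    ∫ x in Set.Icc (0 : ℝ) (2 * Real.pi / k), Complex.exp (Complex.I * k * m * x) =
      if m = 0 then ((2 * Real.pi / k : ℝ) : ℂ) else 0 := by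
  have hL : 0 ≤ 2 * Real.pi / k := by positivity
  rw [integral_Icc_eq_integral_Ioc, ← intervalIntegral.integral_of_le hL]
  split_ifs with hm
  · simp [hm]
  · have hc : Complex.I * k * m ≠ 0 := by
      simp [hm, hk.ne']
    rw [integral_exp_mul_complex hc]
    have : Complex.I * k * m * ((2 * Real.pi / k : ℝ) : ℂ) = m * (2 * Real.pi * Complex.I) := by
      have : (k : ℂ) ≠ 0 := by exact_mod_cast hk.ne'
      push_cast
      field_simp
    rw [this, Complex.exp_int_mul_two_pi_mul_I]
    simp

theorem integral_prod_lineFactor_pow {k : ℝ} (hk : 0 < k) (s n : I → ℕ) :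
    ∫ b in Set.Icc (0 : I → ℝ) (fun _ => 2 * Real.pi / k),
      (∏ i, lineFactor (k : ℂ) b i ^ s i) * Complex.exp (-(Complex.I * k * (pairing n b : ℂ))) =
      if s = n then ((2 * Real.pi / k : ℝ) : ℂ) ^ Fintype.card I else 0 := by
  have h1 : ∀ b : I → ℝ,
      (∏ i, lineFactor (k : ℂ) b i ^ s i) * Complex.exp (-(Complex.I * k * (pairing n b : ℂ))) =
        ∏ i, Complex.exp (Complex.I * k * ((s i - n i : ℤ) : ℂ) * b i) := by
    intro b
    have h2 : Complex.exp (-(Complex.I * k * (pairing n b : ℂ))) =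
        ∏ i, Complex.exp (-(Complex.I * k * (n i * b i))) := by
      rw [← Complex.exp_sum, pairing]
      congr 1
      push_cast
      rw [Finset.mul_sum, Finset.sum_neg_distrib]
    rw [h2, ← Finset.prod_mul_distrib]
    refine Finset.prod_congr rfl fun i _ => ?_
    rw [lineFactor, ← Complex.exp_nat_mul, ← Complex.exp_add]
    congr 1
    push_cast
    ring
  simp only [h1]
  rw [← Set.pi_univ_Icc, volume_pi, Measure.restrict_pi_pi,
    integral_fintype_prod_eq_prod (𝕜 := ℂ)
      (f := fun i (x : ℝ) => Complex.exp (Complex.I * k * ((s i - n i : ℤ) : ℂ) * x))]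
  simp only [Pi.zero_apply, integral_exp_mul_int hk, sub_eq_zero, Nat.cast_inj]
  split_ifs with h
  · simp [h, div_pow]
  · obtain ⟨i, hi⟩ := Function.ne_iff.1 h
    exact Finset.prod_eq_zero (Finset.mem_univ i) (if_neg hi)

variable {V : Type*} [DecidableEq V] {G : LineGraph V E I}

theorem continuous_lineFactor (k : ℂ) (i : I) : Continuous fun b : I → ℝ => lineFactor k b i := by
  unfold lineFactor
  fun_prop

theorem continuous_exp_pairing (k : ℂ) (n : I → ℕ) :
    Continuous fun b : I → ℝ => Complex.exp (-(Complex.I * k * (pairing n b : ℂ))) := by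
  unfold pairing
  fun_prop

theorem continuous_pow_mul_apply (hG : ∀ x y, G.vert x ≠ G.vert y → M x y = 0) (k : ℂ) (N : ℕ)
    (e e' : E) : Continuous fun b : I → ℝ =>
      ((M * hop E (lineFactor k b)) ^ N * M) (Sum.inl e) (Sum.inl e') := by
  simp only [pow_mul_apply_inl_inl hG]
  have := continuous_lineFactor (I := I) k
  fun_prop

theorem continuous_damped (hM : Mᴴ * M = 1) (hG : ∀ x y, G.vert x ≠ G.vert y → M x y = 0)
    (k : ℝ) {r : ℝ} (hr : 0 ≤ r) (hr1 : r < 1) (e e' : E) :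
    Continuous fun b : I → ℝ => damped M (lineFactor k b) r e e' :=
  continuous_tsum (fun N => (continuous_pow_mul_apply hG k N e e').const_mul _)
    (summable_geometric_of_lt_one hr hr1)
    fun N b => norm_pow_mul_apply_inl_le hM (norm_lineFactor_ofReal k b) hr N _ e'

theorem isFiniteMeasure_restrict_box (L : ℝ) :
    IsFiniteMeasure (volume.restrict (Set.Icc (0 : I → ℝ) (fun _ => L))) :=
  ⟨by rw [Measure.restrict_apply_univ]; exact isCompact_Icc.measure_lt_top⟩

theorem integral_pow_mul_apply (hG : ∀ x y, G.vert x ≠ G.vert y → M x y = 0) {k : ℝ} (hk : 0 < k)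
    (n : I → ℕ) (N : ℕ) (e e' : E) :
    ∫ b in Set.Icc (0 : I → ℝ) (fun _ => 2 * Real.pi / k),
      ((M * hop E (lineFactor k b)) ^ N * M) (Sum.inl e) (Sum.inl e') *
        Complex.exp (-(Complex.I * k * (pairing n b : ℂ))) =
      ((2 * Real.pi / k : ℝ) : ℂ) ^ Fintype.card I *
        ∑ r : G.Route e' e N, if r.toWalk.score = n then r.toWalk.amplitude M else 0 := by
  simp only [pow_mul_apply_inl_inl hG, Finset.sum_mul, mul_assoc (Walk.amplitude _ _)]
  rw [integral_finsetSum]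
  · simp only [integral_const_mul, integral_prod_lineFactor_pow hk, Finset.mul_sum]
    refine Finset.sum_congr rfl fun r _ => ?_
    split_ifs <;> ring
  · intro r _
    apply Continuous.integrableOn_Icc
    have := continuous_lineFactor (I := I) k
    have := continuous_exp_pairing (I := I) k n
    fun_prop

/-- The terms are bounded by r^N, so sum and integral commute. By orthogonality of the exponentials
only walks with score n survive, and these all have length ∑ n_i, which produces the single power of
r. -/
theorem integral_damped (hM : Mᴴ * M = 1) (hG : ∀ x y, G.vert x ≠ G.vert y → M x y = 0) {k : ℝ}
    (hk : 0 < k) (n : I → ℕ) {r : ℝ} (hr : 0 ≤ r) (hr1 : r < 1) (e e' : E) :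
    ∫ b in Set.Icc (0 : I → ℝ) (fun _ => 2 * Real.pi / k),
      damped M (lineFactor k b) r e e' * Complex.exp (-(Complex.I * k * (pairing n b : ℂ))) =
      (r : ℂ) ^ (∑ i, n i) * (((2 * Real.pi / k : ℝ) : ℂ) ^ Fintype.card I *
        ∑ r : G.Route e' e (∑ i, n i),
          if r.toWalk.score = n then r.toWalk.amplitude M else 0) := by
  have := isFiniteMeasure_restrict_box (I := I) (2 * Real.pi / k)
  have hexp : ∀ b : I → ℝ, ‖Complex.exp (-(Complex.I * k * (pairing n b : ℂ)))‖ = 1 := by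
    intro b
    rw [Complex.norm_exp]
    simp
  have hcont : ∀ N, Continuous fun b : I → ℝ => (r : ℂ) ^ N *
      ((M * hop E (lineFactor k b)) ^ N * M) (Sum.inl e) (Sum.inl e') *
        Complex.exp (-(Complex.I * k * (pairing n b : ℂ))) := fun N =>
    ((continuous_pow_mul_apply hG k N e e').const_mul _).mul (continuous_exp_pairing k n)
  have hle : ∀ N (b : I → ℝ), ‖(r : ℂ) ^ N *
      ((M * hop E (lineFactor k b)) ^ N * M) (Sum.inl e) (Sum.inl e') *
        Complex.exp (-(Complex.I * k * (pairing n b : ℂ)))‖ ≤ r ^ N := by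
    intro N b
    rw [norm_mul, hexp, mul_one]
    exact norm_pow_mul_apply_inl_le hM (norm_lineFactor_ofReal k b) hr N _ e'
  have h1 := hasSum_integral_of_summable_integral_norm
    (μ := volume.restrict (Set.Icc (0 : I → ℝ) (fun _ => 2 * Real.pi / k)))
    (fun N => (hcont N).integrableOn_Icc) ?_
  · have h2 : ∀ b : I → ℝ, damped M (lineFactor k b) r e e' *
        Complex.exp (-(Complex.I * k * (pairing n b : ℂ))) = ∑' N : ℕ, (r : ℂ) ^ N *
      ((M * hop E (lineFactor k b)) ^ N * M) (Sum.inl e) (Sum.inl e') *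
        Complex.exp (-(Complex.I * k * (pairing n b : ℂ))) := fun b => tsum_mul_right.symm
    have h3 : ∀ N, ∫ b in Set.Icc (0 : I → ℝ) (fun _ => 2 * Real.pi / k), (r : ℂ) ^ N *
        ((M * hop E (lineFactor k b)) ^ N * M) (Sum.inl e) (Sum.inl e') *
          Complex.exp (-(Complex.I * k * (pairing n b : ℂ))) =
        (r : ℂ) ^ N * (((2 * Real.pi / k : ℝ) : ℂ) ^ Fintype.card I *
          ∑ r : G.Route e' e N,
            if r.toWalk.score = n then r.toWalk.amplitude M else 0) := fun N => by
      simp only [mul_assoc ((r : ℂ) ^ N)]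
      rw [integral_const_mul, integral_pow_mul_apply hG hk]
    simp only [h3] at h1
    simp only [h2]
    refine h1.unique (hasSum_single (∑ i, n i) fun N hN => ?_)
    rw [Finset.sum_eq_zero fun (r : G.Route e' e N) _ => if_neg ?_, mul_zero, mul_zero]
    intro h
    exact hN (by rw [← r.sum_score_toWalk, h])
  · refine Summable.of_nonneg_of_le (fun N => integral_nonneg fun _ => norm_nonneg _) (fun N => ?_)
      ((summable_geometric_of_lt_one hr hr1).mul_left
        (volume.real (Set.Icc (0 : I → ℝ) (fun _ => 2 * Real.pi / k))))
    refine (integral_mono (hcont N).norm.integrableOn_Icc (integrable_const (r ^ N))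
      (hle N)).trans ?_
    simp

theorem integrableOn_fourierIntegrand_and_eq {A B : Matrix (E ⊕ (I ⊕ I)) (E ⊕ (I ⊕ I)) ℂ}
    (hAB : IsAdmissible A B) (hG : ∀ x y, G.vert x ≠ G.vert y → M x y = 0) {k : ℝ} (hk : 0 < k)
    (hM : (A + (Complex.I * k) • B) * M = -(A - (Complex.I * k) • B)) (n : I → ℕ) (e e' : E) :
    IntegrableOn (fourierIntegrand A B k n e e')
      (Set.Icc (0 : I → ℝ) (fun _ => 2 * Real.pi / k)) ∧
    ∑ r : G.Route e' e (∑ i, n i), (if r.toWalk.score = n then r.toWalk.amplitude M else 0) =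
      fourierCoeff A B k n e e' := by
  have := isFiniteMeasure_restrict_box (I := I) (2 * Real.pi / k)
  have hM' := mul_eq_one_comm.1 (hAB.mul_conjTranspose_eq_one hk hM)
  have hexp : ∀ b : I → ℝ, ‖Complex.exp (-(Complex.I * k * (pairing n b : ℂ)))‖ = 1 := by
    intro b
    rw [Complex.norm_exp]
    simp
  set F : ℝ → (I → ℝ) → ℂ := fun r b => damped M (lineFactor k b) r e e' *
    Complex.exp (-(Complex.I * k * (pairing n b : ℂ))) with hF
  have hlim : ∀ b, Tendsto (fun r => F r b) (𝓝[<] 1) (𝓝 (fourierIntegrand A B k n e e' b)) :=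
    fun b => (tendsto_damped_scatteringMatrix hAB hk b hM e e').mul_const _
  have hev : ∀ᶠ r : ℝ in 𝓝[<] 1, 0 ≤ r ∧ r < 1 := by
    filter_upwards [Ioo_mem_nhdsLT (zero_lt_one' ℝ)] with r hr using ⟨hr.1.le, hr.2⟩
  have hbound : ∀ᶠ r : ℝ in 𝓝[<] 1, ∀ b, ‖F r b‖ ≤ 1 := by
    filter_upwards [hev] with r hr b
    rw [hF, norm_mul, hexp, mul_one]
    exact norm_damped_le_one hM' (norm_lineFactor_ofReal k b) hr.1 hr.2 e e'
  have hcont : ∀ᶠ r : ℝ in 𝓝[<] 1, Continuous (F r) := by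
    filter_upwards [hev] with r hr
    exact (continuous_damped hM' hG k hr.1 hr.2 e e').mul (continuous_exp_pairing k n)
  set μ := volume.restrict (Set.Icc (0 : I → ℝ) (fun _ => 2 * Real.pi / k)) with hμ
  have hb : ∀ b, ‖fourierIntegrand A B k n e e' b‖ ≤ 1 := fun b =>
    le_of_tendsto (hlim b).norm (hbound.mono fun r hr => hr b)
  -- The integrand is a pointwise limit of continuous functions along a sequence r → 1; the shift by
  -- m drops the indices at which continuity is not known.
  have hmeas : AEStronglyMeasurable (fourierIntegrand A B k n e e') μ := by
    obtain ⟨u, hu⟩ := exists_seq_tendsto (𝓝[<] (1 : ℝ))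
    obtain ⟨m, hm⟩ := eventually_atTop.1 (hu.eventually hcont)
    exact aestronglyMeasurable_of_tendsto_ae atTop
      (f := fun j => F (u (j + m))) (fun j => (hm _ (Nat.le_add_left m j)).aestronglyMeasurable)
      (Eventually.of_forall fun b => ((hlim b).comp hu).comp (tendsto_add_atTop_nat m))
  refine ⟨Integrable.of_bound hmeas 1 (Eventually.of_forall hb), ?_⟩
  have h1 : Tendsto (fun r => ∫ b, F r b ∂μ) (𝓝[<] 1)
      (𝓝 (∫ b, fourierIntegrand A B k n e e' b ∂μ)) :=
    tendsto_integral_filter_of_dominated_convergence (fun _ => 1)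
      (hcont.mono fun r hr => hr.aestronglyMeasurable)
      (hbound.mono fun r hr => Eventually.of_forall hr) (integrable_const 1)
      (Eventually.of_forall hlim)
  have h2 : Tendsto (fun r => ∫ b, F r b ∂μ) (𝓝[<] 1)
      (𝓝 ((((1 : ℝ) : ℂ)) ^ (∑ i, n i) * (((2 * Real.pi / k : ℝ) : ℂ) ^ Fintype.card I *
        ∑ r : G.Route e' e (∑ i, n i),
          if r.toWalk.score = n then r.toWalk.amplitude M else 0))) := by
    refine Tendsto.congr'
      (hev.mono fun r hr => (integral_damped hM' hG hk n hr.1 hr.2 e e').symm) ?_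
    have hc : Continuous fun r : ℝ => (r : ℂ) ^ (∑ i, n i) *
        (((2 * Real.pi / k : ℝ) : ℂ) ^ Fintype.card I * ∑ r : G.Route e' e (∑ i, n i),
          if r.toWalk.score = n then r.toWalk.amplitude M else 0) := by fun_prop
    exact (hc.tendsto 1).mono_left nhdsWithin_le_nhds
  rw [fourierCoeff, tendsto_nhds_unique h1 h2, Complex.ofReal_one, one_pow, one_mul, ← mul_assoc,
    Complex.ofReal_pow, ← mul_pow, ← Complex.ofReal_mul]
  have h3 : k / (2 * Real.pi) * (2 * Real.pi / k) = 1 := by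
    have := hk.ne'
    field_simp
  rw [h3, Complex.ofReal_one, one_pow, one_mul]

end Fourier

/-! ### Boundedness of M for large |k|. -/

section HighEnergy

open Filter Bornology Polynomial

/-- If deg p exceeded deg q, then |p| ≤ |q| ≤ |p|/2 at all large real x, so p would have infinitely
many roots. Thus deg p ≤ deg q, which controls p by q in every complex direction. -/
theorem exists_norm_eval_le_of_forall_real {p q : ℂ[X]}
    (h : ∀ x : ℝ, 0 < x → ‖p.eval (x : ℂ)‖ ≤ ‖q.eval (x : ℂ)‖) :
    ∃ C R : ℝ, ∀ k : ℂ, R < ‖k‖ → ‖p.eval k‖ ≤ C * ‖q.eval k‖ := by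
  by_cases hd : p.degree ≤ q.degree
  · obtain ⟨C, hC⟩ := (isBigO_cobounded_of_degree_le hd).bound
    rw [← comap_norm_atTop, eventually_comap] at hC
    obtain ⟨R, hR⟩ := eventually_atTop.1 hC
    exact ⟨C, R, fun k hk => hR _ hk.le k rfl⟩
  · exfalso
    push Not at hd
    have h1 := (isLittleO_cobounded_of_degree_lt hd).bound (half_pos zero_lt_one)
    rw [← comap_norm_atTop, eventually_comap] at h1
    obtain ⟨R, hR⟩ := eventually_atTop.1 h1
    have h2 : ∀ x : ℝ, max R 1 < x → p.IsRoot (x : ℂ) := by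
      intro x hx
      have hx0 : 0 < x := lt_trans (lt_of_lt_of_le one_pos (le_max_right _ _)) hx
      have h3 := hR x ((le_max_left _ _).trans hx.le) (x : ℂ)
        (by rw [Complex.norm_real, Real.norm_of_nonneg hx0.le])
      have h4 := h x hx0
      have h5 : ‖p.eval (x : ℂ)‖ ≤ 0 := by linarith
      exact norm_le_zero_iff.1 h5
    have h3 : p = 0 := by
      apply eq_zero_of_infinite_isRoot
      refine Set.Infinite.mono ?_
        ((Set.Ioi_infinite (max R 1)).image (Complex.ofReal_injective.injOn))
      rintro _ ⟨x, hx, rfl⟩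
      exact h2 x hx
    rw [h3, degree_zero] at hd
    exact not_lt_bot hd

variable {E I : Type*} [Fintype E] [Fintype I] [DecidableEq E] [DecidableEq I]
  {A B : Matrix (E ⊕ (I ⊕ I)) (E ⊕ (I ⊕ I)) ℂ}

open Matrix in
theorem norm_apply_le_one_of_unitary {n : Type*} [Fintype n] [DecidableEq n] {M : Matrix n n ℂ}
    (hM : Mᴴ * M = 1) (x y : n) : ‖M x y‖ ≤ 1 := by
  have h1 := norm_apply_le_l2norm (M *ᵥ Pi.single y 1) x
  have h2 : l2norm (Pi.single y (1 : ℂ)) ^ 2 = 1 := by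
    rw [l2norm_sq]
    simp [Pi.single_apply, apply_ite]
  rw [l2norm_mulVec hM, (pow_eq_one_iff_of_nonneg (l2norm_nonneg _) two_ne_zero).1 h2,
    mulVec_single_one] at h1
  exact h1

/-- The scattering matrix of the boundary conditions is bounded at high energies. -/
theorem IsAdmissible.exists_norm_apply_le (h : IsAdmissible A B) :
    ∃ C R : ℝ, ∀ k : ℂ, 0 < k.re → R < ‖k‖ → ∀ M : Matrix (E ⊕ (I ⊕ I)) (E ⊕ (I ⊕ I)) ℂ,
      (A + (Complex.I * k) • B) * M = -(A - (Complex.I * k) • B) → ∀ x y, ‖M x y‖ ≤ C := by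
  set P : Matrix (E ⊕ (I ⊕ I)) (E ⊕ (I ⊕ I)) ℂ[X] :=
    A.map C + (X * C Complex.I : ℂ[X]) • B.map C with hP
  set Q : Matrix (E ⊕ (I ⊕ I)) (E ⊕ (I ⊕ I)) ℂ[X] :=
    A.map C - (X * C Complex.I : ℂ[X]) • B.map C with hQ
  have hPk : ∀ k, (evalRingHom k).mapMatrix P = A + (Complex.I * k) • B := by
    intro k
    ext x y
    simp [hP]
  have hQk : ∀ k, (evalRingHom k).mapMatrix Q = A - (Complex.I * k) • B := by
    intro k
    ext x y
    simp [hQ]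
  have hdet : ∀ k, P.det.eval k = (A + (Complex.I * k) • B).det := by
    intro k
    rw [← hPk, ← RingHom.map_det]
    rfl
  -- Cramer's rule: M has polynomial entries over the common denominator det(A + ikB). Unitarity at
  -- k > 0 then bounds each numerator by the denominator there.
  have key : ∀ k (M : Matrix (E ⊕ (I ⊕ I)) (E ⊕ (I ⊕ I)) ℂ),
      (A + (Complex.I * k) • B) * M = -(A - (Complex.I * k) • B) →
      ∀ x y, P.det.eval k * M x y = ((-(P.adjugate * Q)) x y).eval k := by
    intro k M hM x y
    have h1 : ((-(P.adjugate * Q)) x y).eval k =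
        ((evalRingHom k).mapMatrix (-(P.adjugate * Q))) x y := rfl
    rw [h1, map_neg, map_mul, RingHom.map_adjugate, hPk, hQk, ← Matrix.mul_neg, ← hM,
      ← Matrix.mul_assoc, Matrix.adjugate_mul, Matrix.smul_mul, Matrix.one_mul, hdet]
    rfl
  have hne : ∀ k : ℂ, 0 < k.re → P.det.eval k ≠ 0 := by
    intro k hk
    rw [hdet]
    exact ((Matrix.isUnit_iff_isUnit_det _).1 (h.isUnit_add hk)).ne_zero
  have hb : ∀ x y, ∃ C R : ℝ, ∀ k : ℂ, R < ‖k‖ →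
      ‖((-(P.adjugate * Q)) x y).eval k‖ ≤ C * ‖P.det.eval k‖ := by
    intro x y
    apply exists_norm_eval_le_of_forall_real
    intro k hk
    have hu := h.isUnit_add (k := k) (by simpa using hk)
    have hM : (A + (Complex.I * k) • B) *
        (-((A + (Complex.I * k) • B)⁻¹ * (A - (Complex.I * k) • B))) =
        -(A - (Complex.I * k) • B) := by
      rw [Matrix.mul_neg, ← Matrix.mul_assoc,
        Matrix.mul_nonsing_inv _ ((Matrix.isUnit_iff_isUnit_det _).1 hu), Matrix.one_mul]
    rw [← key k _ hM, norm_mul]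
    exact mul_le_of_le_one_right (norm_nonneg _)
      (norm_apply_le_one_of_unitary (mul_eq_one_comm.1 (h.mul_conjTranspose_eq_one hk hM)) x y)
  choose C R hCR using hb
  refine ⟨∑ x, ∑ y, |C x y|, ∑ x, ∑ y, |R x y|, fun k hk hRk M hM x y => ?_⟩
  have hle : ∀ f : E ⊕ (I ⊕ I) → E ⊕ (I ⊕ I) → ℝ, f x y ≤ ∑ x, ∑ y, |f x y| := by
    intro f
    refine (le_abs_self _).trans ((Finset.single_le_sum (f := fun y => |f x y|)
      (fun _ _ => abs_nonneg _) (Finset.mem_univ y)).trans ?_)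
    exact Finset.single_le_sum (f := fun x => ∑ y, |f x y|)
      (fun _ _ => Finset.sum_nonneg fun _ _ => abs_nonneg _) (Finset.mem_univ x)
  refine le_trans ?_ (hle C)
  have h1 := hCR x y k ((hle R).trans_lt hRk)
  rw [← key k M hM, norm_mul, mul_comm] at h1
  exact le_of_mul_le_mul_right h1 (norm_pos_iff.2 (hne k hk))

end HighEnergy

/-! ### Absolute convergence of the sum over walks and regrouping by score. -/

section WalkExpansion

variable {V E I : Type*} [Fintype E] [Fintype I] [DecidableEq V] [DecidableEq E] [DecidableEq I]
  {G : LineGraph V E I} {M : Matrix (E ⊕ (I ⊕ I)) (E ⊕ (I ⊕ I)) ℂ} {z : I → ℂ}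

/-- Each column of `hop` has at most one nonzero entry, so the number of ends does not enter. -/
theorem norm_mul_hop_apply_le {C ε : ℝ} (hC : ∀ x y, ‖M x y‖ ≤ C) (hε : 0 ≤ ε)
    (hz : ∀ i, ‖z i‖ ≤ ε) (x y : E ⊕ (I ⊕ I)) : ‖(M * hop E z) x y‖ ≤ C * ε := by
  have hC0 : 0 ≤ C := (norm_nonneg _).trans (hC x x)
  rw [← Matrix.mul_one (hop E z), mul_hop_mul_apply]
  rcases y with y | y
  · simp
    positivity
  · rw [Finset.sum_eq_single y]
    · rw [Matrix.one_apply_eq, mul_one, norm_mul]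
      exact mul_le_mul (hC _ _) (hz _) (norm_nonneg _) hC0
    · intro h _ hne
      rw [Matrix.one_apply_ne (fun h' => hne (Sum.inr_injective h')), mul_zero, mul_zero]
    · exact fun h => absurd (Finset.mem_univ y) h

theorem Route.norm_amplitude_mul_le {e e' : E} {N : ℕ} (r : G.Route e' e N) {C ε : ℝ}
    (hC : ∀ x y, ‖M x y‖ ≤ C) (hz : ∀ i, ‖z i‖ ≤ ε) :
    ‖r.toWalk.amplitude M * ∏ i, z i ^ r.toWalk.score i‖ ≤ C * (C * ε) ^ N := by
  have hC0 : 0 ≤ C := (norm_nonneg _).trans (hC (Sum.inl e) (Sum.inl e))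
  rw [r.prod_pow_score_toWalk, r.amplitude_toWalk, norm_mul, norm_prod, norm_prod]
  have h1 : ∏ j : Fin (N + 1), ‖M (pathOut (Sum.inl e) r.1 j) (pathIn (Sum.inl e') r.1 j)‖ ≤
      C ^ (N + 1) := by
    refine (Finset.prod_le_prod (fun _ _ => norm_nonneg _) fun j _ => hC _ _).trans ?_
    simp
  have h2 : ∏ j : Fin N, ‖z (endLine (r.1 j))‖ ≤ ε ^ N := by
    refine (Finset.prod_le_prod (fun _ _ => norm_nonneg _) fun j _ => hz _).trans ?_
    simp
  calc _ ≤ C ^ (N + 1) * ε ^ N :=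
        mul_le_mul h1 h2 (Finset.prod_nonneg fun _ _ => norm_nonneg _) (by positivity)
    _ = _ := by ring

/-- There are at most card^N routes with N steps, each of size at most C (Cε)^N, so the geometric
series of ratio 1/2 dominates. -/
theorem summable_route {C ε : ℝ} (hC : ∀ x y, ‖M x y‖ ≤ C) (hε : 0 ≤ ε) (hz : ∀ i, ‖z i‖ ≤ ε)
    (hCε : Fintype.card (E ⊕ (I ⊕ I)) * (C * ε) ≤ 1 / 2) (e e' : E) :
    Summable fun r : Σ N, G.Route e' e N =>
      r.2.toWalk.amplitude M * ∏ i, z i ^ r.2.toWalk.score i := by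
  have hC0 : 0 ≤ C := (norm_nonneg _).trans (hC (Sum.inl e) (Sum.inl e))
  apply Summable.of_norm
  rw [summable_sigma_of_nonneg fun _ => norm_nonneg _]
  refine ⟨fun N => (hasSum_fintype _).summable, ?_⟩
  refine Summable.of_nonneg_of_le (fun N => tsum_nonneg fun _ => norm_nonneg _) (fun N => ?_)
    ((summable_geometric_of_lt_one (by norm_num : (0 : ℝ) ≤ 1 / 2) (by norm_num)).mul_left C)
  rw [tsum_fintype]
  have hcard : (Fintype.card (G.Route e' e N) : ℝ) ≤ (Fintype.card (E ⊕ (I ⊕ I)) : ℝ) ^ N := by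
    have h1 : Fintype.card (G.Route e' e N) ≤ Fintype.card (E ⊕ (I ⊕ I)) ^ N := by
      refine (Fintype.card_subtype_le _).trans ?_
      rw [Fintype.card_fun, Fintype.card_fin]
      refine Nat.pow_le_pow_left ?_ N
      rw [Fintype.card_sum (α := E)]
      exact Nat.le_add_left _ _
    exact_mod_cast h1
  calc ∑ r : G.Route e' e N, ‖r.toWalk.amplitude M * ∏ i, z i ^ r.toWalk.score i‖
      ≤ ∑ _r : G.Route e' e N, C * (C * ε) ^ N :=
        Finset.sum_le_sum fun r _ => r.norm_amplitude_mul_le hC hz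
    _ = Fintype.card (G.Route e' e N) * (C * (C * ε) ^ N) := by
        rw [Finset.sum_const, Finset.card_univ, nsmul_eq_mul]
    _ ≤ (Fintype.card (E ⊕ (I ⊕ I)) : ℝ) ^ N * (C * (C * ε) ^ N) := by gcongr
    _ = C * (Fintype.card (E ⊕ (I ⊕ I)) * (C * ε)) ^ N := by ring
    _ ≤ C * (1 / 2) ^ N := by gcongr

/-- The Neumann series solves the system, and invertibility identifies it with O; absolute
summability over all walks allows grouping them by length. -/
theorem hasSum_walk (hG : ∀ x y, G.vert x ≠ G.vert y → M x y = 0) {C ε : ℝ}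
    (hC : ∀ x y, ‖M x y‖ ≤ C) (hε : 0 ≤ ε) (hz : ∀ i, ‖z i‖ ≤ ε)
    (hCε : Fintype.card (E ⊕ (I ⊕ I)) * (C * ε) ≤ 1 / 2)
    {O : Matrix (E ⊕ (I ⊕ I)) E ℂ} (hu : IsUnit (1 - M * hop E z))
    (hO : (1 - M * hop E z) * O = M * extIncl E I) (e e' : E) :
    HasSum (fun w : G.Walk e' e => w.amplitude M * ∏ i, z i ^ w.score i) (O (Sum.inl e) e') := by
  have hsum : ∀ x y, Summable fun N : ℕ => ((M * hop E z) ^ N * (M * extIncl E I)) x y := by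
    intro x y
    have hC0 : 0 ≤ C := (norm_nonneg _).trans (hC x x)
    refine Summable.of_norm_bounded
      ((summable_geometric_of_lt_one (by norm_num : (0 : ℝ) ≤ 1 / 2) (by norm_num)).mul_right C)
      fun N => (norm_pow_mul_apply_le (norm_mul_hop_apply_le hC hε hz)
        (fun x y => by rw [mul_extIncl_apply]; exact hC _ _) N x y).trans ?_
    gcongr
  have hO' : O = Matrix.of fun x y => ∑' N : ℕ, ((M * hop E z) ^ N * (M * extIncl E I)) x y := by
    have h1 := hO.trans (one_sub_mul_tsum _ _ hsum).symm
    have h2 := congrArg ((1 - M * hop E z)⁻¹ * ·) h1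
    simpa [← Matrix.mul_assoc,
      Matrix.nonsing_inv_mul _ ((Matrix.isUnit_iff_isUnit_det _).1 hu)] using h2
  have h1 := summable_route (G := G) hC hε hz hCε e e'
  rw [← (routeEquiv G e' e).hasSum_iff]
  have h2 := h1.hasSum
  rw [h1.tsum_sigma] at h2
  rw [hO', Matrix.of_apply]
  convert! h2 using 1
  refine tsum_congr fun N => ?_
  rw [tsum_fintype, ← Matrix.mul_assoc, mul_extIncl_apply, pow_mul_apply_inl_inl hG]

theorem finite_setOf_score_eq (e e' : E) (n : I → ℕ) : {w : G.Walk e' e | w.score = n}.Finite := by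
  refine (Set.toFinite (Set.range fun r : G.Route e' e (∑ i, n i) => r.toWalk)).subset ?_
  intro w hw
  obtain ⟨⟨N, r⟩, rfl⟩ := Route.toWalk_surjective w
  have hN : ∑ i, n i = N := by
    rw [← r.sum_score_toWalk]
    exact congrArg (fun n : I → ℕ => ∑ i, n i) hw.symm
  subst hN
  exact ⟨r, rfl⟩

/-- The factor in z depends on the score alone, and each score belongs to finitely many walks, so
the inner sum is a `finsum` without default value. -/
theorem hasSum_scores {e e' : E} {S : ℂ}
    (h : HasSum (fun w : G.Walk e' e => w.amplitude M * ∏ i, z i ^ w.score i) S) :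
    HasSum (fun n : G.scores e e' =>
      (∑ᶠ (w : G.Walk e' e) (_ : w.score = n), w.amplitude M) * ∏ i, z i ^ (n : I → ℕ) i) S := by
  let s : G.Walk e' e → G.scores e e' := fun w => ⟨w.score, w, rfl⟩
  have h1 := (Equiv.sigmaFiberEquiv s).hasSum_iff.2 h
  refine h1.sigma fun n => ?_
  have hfin : Finite {w : G.Walk e' e // s w = n} := by
    refine Set.Finite.subset (finite_setOf_score_eq e e' (n : I → ℕ)) ?_
    intro w hw
    exact congrArg Subtype.val hw
  have h2 : ∑ᶠ (w : G.Walk e' e) (_ : w.score = n), w.amplitude M =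
      ∑' w : {w : G.Walk e' e // s w = n}, w.1.amplitude M := by
    rw [tsum_eq_finsum (Set.toFinite _),
      finsum_subtype_eq_finsum_cond (f := fun w => w.amplitude M) fun w => s w = n]
    exact finsum_congr fun w => finsum_congr_Prop
      (propext ⟨fun h => Subtype.ext h, fun h => congrArg Subtype.val h⟩) fun _ => rfl
  rw [h2, ← tsum_mul_right]
  have h3 : ∀ w : {w : G.Walk e' e // s w = n},
      w.1.amplitude M * ∏ i, z i ^ (n : I → ℕ) i =
        w.1.amplitude M * ∏ i, z i ^ w.1.score i := by
    rintro ⟨w, rfl⟩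
    rfl
  simp only [h3]
  exact (Summable.of_finite).hasSum

end WalkExpansion

/-! ### Analytic and meromorphic dependence on k by Cramer's rule. -/

section Analytic

open Filter Topology

variable {n : Type*} [Fintype n] [DecidableEq n] {F : ℂ → Matrix n n ℂ} {k₀ : ℂ}

theorem analyticAt_det (h : ∀ i j, AnalyticAt ℂ (fun k => F k i j) k₀) :
    AnalyticAt ℂ (fun k => (F k).det) k₀ := by
  simp only [Matrix.det_apply']
  exact Finset.analyticAt_fun_sum _ fun σ _ =>
    analyticAt_const.mul (Finset.analyticAt_fun_prod _ fun i _ => h _ _)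

theorem analyticAt_adjugate (h : ∀ i j, AnalyticAt ℂ (fun k => F k i j) k₀) (i j : n) :
    AnalyticAt ℂ (fun k => (F k).adjugate i j) k₀ := by
  simp only [Matrix.adjugate_apply]
  refine analyticAt_det fun i' j' => ?_
  simp only [Matrix.updateRow_apply]
  split_ifs
  · exact analyticAt_const
  · exact h _ _

theorem analyticAt_mul_apply {l m : Type*} {P : ℂ → Matrix l n ℂ} {Q : ℂ → Matrix n m ℂ}
    (hP : ∀ i j, AnalyticAt ℂ (fun k => P k i j) k₀)
    (hQ : ∀ i j, AnalyticAt ℂ (fun k => Q k i j) k₀) (i : l) (j : m) :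
    AnalyticAt ℂ (fun k => (P k * Q k) i j) k₀ := by
  simp only [Matrix.mul_apply]
  exact Finset.analyticAt_fun_sum _ fun x _ => (hP _ _).mul (hQ _ _)

theorem inv_mul_apply_eq {m : Type*} (F : Matrix n n ℂ) (Q : Matrix n m ℂ) (i : n) (j : m) :
    (F⁻¹ * Q) i j = F.det⁻¹ * (F.adjugate * Q) i j := by
  rw [Matrix.inv_def, Ring.inverse_eq_inv', Matrix.smul_mul, Matrix.smul_apply, smul_eq_mul]

theorem analyticAt_inv_mul_apply {m : Type*} {Q : ℂ → Matrix n m ℂ}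
    (h : ∀ i j, AnalyticAt ℂ (fun k => F k i j) k₀)
    (hQ : ∀ i j, AnalyticAt ℂ (fun k => Q k i j) k₀) (hdet : (F k₀).det ≠ 0) (i : n) (j : m) :
    AnalyticAt ℂ (fun k => ((F k)⁻¹ * Q k) i j) k₀ := by
  simp only [inv_mul_apply_eq]
  exact ((analyticAt_det h).inv hdet).mul (analyticAt_mul_apply (analyticAt_adjugate h) hQ i j)

theorem meromorphicAt_inv_mul_apply {m : Type*} {Q : ℂ → Matrix n m ℂ}
    (h : ∀ i j, AnalyticAt ℂ (fun k => F k i j) k₀)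
    (hQ : ∀ i j, AnalyticAt ℂ (fun k => Q k i j) k₀) (i : n) (j : m) :
    MeromorphicAt (fun k => ((F k)⁻¹ * Q k) i j) k₀ := by
  simp only [inv_mul_apply_eq]
  exact (analyticAt_det h).meromorphicAt.inv.mul
    (analyticAt_mul_apply (analyticAt_adjugate h) hQ i j).meromorphicAt

variable {E I : Type*} [Fintype E] [Fintype I] [DecidableEq E] [DecidableEq I]
  (A B : Matrix (E ⊕ (I ⊕ I)) (E ⊕ (I ⊕ I)) ℂ) (a : I → ℝ)

/-- The matrix of the linear system for the outgoing amplitudes. -/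
noncomputable def outMat (k : ℂ) : Matrix (E ⊕ (I ⊕ I)) (E ⊕ (I ⊕ I)) ℂ :=
  (A + (Complex.I * k) • B) + (A - (Complex.I * k) • B) * hop E (lineFactor k a)

theorem analyticAt_add_smul_apply {n : Type*} (P Q : Matrix n n ℂ) (k₀ : ℂ) (i j : n) :
    AnalyticAt ℂ (fun k => (P + (Complex.I * k) • Q) i j) k₀ := by
  simp only [Matrix.add_apply, Matrix.smul_apply, smul_eq_mul]
  fun_prop

theorem analyticAt_sub_smul_apply {n : Type*} (P Q : Matrix n n ℂ) (k₀ : ℂ) (i j : n) :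
    AnalyticAt ℂ (fun k => (P - (Complex.I * k) • Q) i j) k₀ := by
  simp only [Matrix.sub_apply, Matrix.smul_apply, smul_eq_mul]
  fun_prop

theorem analyticAt_hop_apply (k₀ : ℂ) (x y : E ⊕ (I ⊕ I)) :
    AnalyticAt ℂ (fun k => hop E (lineFactor k a) x y) k₀ := by
  have h : ∀ i j, AnalyticAt ℂ (fun k => Matrix.diagonal (lineFactor k a) i j) k₀ := by
    intro i j
    simp only [Matrix.diagonal_apply, lineFactor]
    split_ifs <;> fun_prop
  rcases x with x | x | x <;> rcases y with y | y | y <;>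
    first
    | exact analyticAt_const
    | exact h x y

theorem analyticAt_outMat_apply (k₀ : ℂ) (x y : E ⊕ (I ⊕ I)) :
    AnalyticAt ℂ (fun k => outMat A B a k x y) k₀ :=
  (analyticAt_add_smul_apply A B k₀ x y).add
    (analyticAt_mul_apply (analyticAt_sub_smul_apply A B k₀) (analyticAt_hop_apply a k₀) x y)

/-- The right-hand side of the linear system for the outgoing amplitudes. -/
noncomputable def outRhs (k : ℂ) : Matrix (E ⊕ (I ⊕ I)) E ℂ :=
  -((A - (Complex.I * k) • B) * extIncl E I)

theorem analyticAt_outRhs_apply (k₀ : ℂ) (x : E ⊕ (I ⊕ I)) (y : E) :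
    AnalyticAt ℂ (fun k => outRhs A B k x y) k₀ := by
  have h := analyticAt_mul_apply (Q := fun _ => extIncl E I) (analyticAt_sub_smul_apply A B k₀)
    (fun _ _ => analyticAt_const) x y
  simp only [outRhs, Matrix.neg_apply]
  exact h.neg

variable {A B a}

theorem isScatteringMatrix_iff_of_det_ne_zero {k : ℂ} (h : (outMat A B a k).det ≠ 0)
    (S : Matrix E E ℂ) : IsScatteringMatrix A B k a S ↔
      S = ((outMat A B a k)⁻¹ * outRhs A B k).toRows₁ := by
  rw [isScatteringMatrix_iff]
  have hu := isUnit_iff_ne_zero.2 h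
  constructor
  · rintro ⟨O, rfl, hO⟩
    have h1 : outMat A B a k * O = outRhs A B k := hO
    rw [← h1, ← Matrix.mul_assoc, Matrix.nonsing_inv_mul _ hu, Matrix.one_mul]
  · rintro rfl
    refine ⟨_, rfl, ?_⟩
    change outMat A B a k * _ = outRhs A B k
    rw [← Matrix.mul_assoc, Matrix.mul_nonsing_inv _ hu, Matrix.one_mul]

theorem existsUnique_isScatteringMatrix_of_det_ne_zero {k : ℂ} (h : (outMat A B a k).det ≠ 0) :
    ∃! S, IsScatteringMatrix A B k a S :=
  ⟨_, (isScatteringMatrix_iff_of_det_ne_zero h _).2 rfl,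
    fun _ hS => (isScatteringMatrix_iff_of_det_ne_zero h _).1 hS⟩

theorem scatteringMatrix_apply_of_det_ne_zero {k : ℂ} (h : (outMat A B a k).det ≠ 0) (e e' : E) :
    scatteringMatrix A B k a e e' = ((outMat A B a k)⁻¹ * outRhs A B k) (Sum.inl e) e' := by
  have h1 : IsScatteringMatrix A B k a (scatteringMatrix A B k a) :=
    Classical.epsilon_spec (existsUnique_isScatteringMatrix_of_det_ne_zero h).exists
  rw [(isScatteringMatrix_iff_of_det_ne_zero h _).1 h1]
  rfl

theorem IsAdmissible.det_outMat_ne_zero (hAB : IsAdmissible A B) {k : ℂ} (hre : 0 < k.re)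
    (him : 0 < k.im) (ha : ∀ i, 0 < a i) : (outMat A B a k).det ≠ 0 :=
  ((Matrix.isUnit_iff_isUnit_det _).1 (hAB.isUnit_add_sub_hop hre him ha)).ne_zero

theorem analyticAt_scatteringMatrix (h : (outMat A B a k₀).det ≠ 0) (e e' : E) :
    AnalyticAt ℂ (fun k => scatteringMatrix A B k a e e') k₀ := by
  refine (analyticAt_inv_mul_apply (analyticAt_outMat_apply A B a k₀)
    (analyticAt_outRhs_apply A B k₀) h (Sum.inl e) e').congr ?_
  -- Near k₀ the system stays invertible, so the arbitrarily chosen values do not occur there.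
  have hev := (analyticAt_det (analyticAt_outMat_apply A B a k₀)).continuousAt.eventually_ne h
  exact hev.mono fun k hk => (scatteringMatrix_apply_of_det_ne_zero hk e e').symm

/-- The determinant is entire and does not vanish at 1 + i, so its zeros are isolated; arbitrary
values at these points do not affect meromorphy. -/
theorem IsAdmissible.meromorphicAt_scatteringMatrix (hAB : IsAdmissible A B) (ha : ∀ i, 0 < a i)
    (k₀ : ℂ) (e e' : E) : MeromorphicAt (fun k => scatteringMatrix A B k a e e') k₀ := by
  refine (meromorphicAt_inv_mul_apply (analyticAt_outMat_apply A B a k₀)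
    (analyticAt_outRhs_apply A B k₀) (Sum.inl e) e').congr ?_
  have hdet : AnalyticOnNhd ℂ (fun k => (outMat A B a k).det) Set.univ :=
    fun k _ => analyticAt_det (analyticAt_outMat_apply A B a k)
  have hev : ∀ᶠ k in 𝓝[≠] k₀, (outMat A B a k).det ≠ 0 := by
    rcases (hdet k₀ (Set.mem_univ _)).eventually_eq_zero_or_eventually_ne_zero with h | h
    · have h1 := hdet.eqOn_zero_of_preconnected_of_eventuallyEq_zero isPreconnected_univ
        (Set.mem_univ k₀) h (Set.mem_univ (1 + Complex.I))
      exact absurd h1 (hAB.det_outMat_ne_zero (by simp) (by simp) ha)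
    · exact h
  exact hev.mono fun k hk => (scatteringMatrix_apply_of_det_ne_zero hk e e').symm

end Analytic

/-! ### Analyticity of the coefficients and the expansion at large Im k. -/

section Main

variable {V E I : Type*} [Fintype V] [Fintype E] [Fintype I] [DecidableEq V] [DecidableEq E]
  [DecidableEq I] (G : LineGraph V E I) {A B : Matrix (E ⊕ (I ⊕ I)) (E ⊕ (I ⊕ I)) ℂ}
  {Av Bv : ∀ v, Matrix (G.Star v) (G.Star v) ℂ}

theorem analyticAt_starSum_vertexScattering (hAB : IsAdmissible A B)
    (hloc : G.IsLocalWith A B Av Bv) {k₀ : ℂ} (hk : 0 < k₀.re) (x y : E ⊕ (I ⊕ I)) :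
    AnalyticAt ℂ (fun k => G.starSum (G.vertexScattering Av Bv k) x y) k₀ := by
  simp only [starSum_apply]
  split_ifs with p
  · exact (analyticAt_inv_mul_apply (analyticAt_add_smul_apply _ _ k₀)
      (analyticAt_sub_smul_apply _ _ k₀) (hloc.isUnit_det G hAB hk _).ne_zero _ _).neg
  · exact analyticAt_const

theorem analyticAt_walkCoeff (hAB : IsAdmissible A B) (hloc : G.IsLocalWith A B Av Bv) {k₀ : ℂ}
    (hk : 0 < k₀.re) (n : I → ℕ) (e e' : E) :
    AnalyticAt ℂ (fun k => G.walkCoeff Av Bv k n e e') k₀ := by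
  simp only [walkCoeff_eq_sum]
  refine Finset.analyticAt_fun_sum _ fun r _ => ?_
  split_ifs
  · exact Finset.analyticAt_fun_prod _ fun j _ =>
      analyticAt_starSum_vertexScattering G hAB hloc hk _ _
  · exact analyticAt_const

theorem prod_lineFactor_pow (k : ℂ) (a : I → ℝ) (n : I → ℕ) :
    ∏ i, lineFactor k a i ^ n i = Complex.exp (Complex.I * k * (pairing n a : ℂ)) := by
  simp only [lineFactor, ← Complex.exp_nat_mul]
  rw [← Complex.exp_sum, pairing]
  congr 1
  push_cast
  rw [Finset.mul_sum]
  exact Finset.sum_congr rfl fun i _ => by ring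

theorem hasSum_walkCoeff (hAB : IsAdmissible A B) (hloc : G.IsLocalWith A B Av Bv) {a : I → ℝ}
    (ha : ∀ i, 0 < a i) : ∃ β₀ : ℝ, 0 < β₀ ∧ ∀ k : ℂ, 0 < k.re → β₀ < k.im → ∀ e e' : E,
      HasSum (fun n : G.scores e e' =>
          G.walkCoeff Av Bv k n e e' *
            Complex.exp (Complex.I * k * (pairing (n : I → ℕ) a : ℂ)))
        (scatteringMatrix A B k a e e') := by
  obtain ⟨C, R, hCR⟩ := hAB.exists_norm_apply_le
  -- The sum serves as the common bound ε for all |e^{ika_i}|; unlike a maximum it needs no case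
  -- distinction when there are no internal lines.
  have hlim : Filter.Tendsto (fun κ : ℝ => ∑ i, Real.exp (-(κ * a i))) Filter.atTop
      (nhds 0) := by
    rw [← Finset.sum_const_zero (s := (Finset.univ : Finset I))]
    refine tendsto_finsetSum _ fun i _ => ?_
    exact Real.tendsto_exp_neg_atTop_nhds_zero.comp (Filter.tendsto_id.atTop_mul_const (ha i))
  have hev : ∀ᶠ κ : ℝ in Filter.atTop, Fintype.card (E ⊕ (I ⊕ I)) *
      (C * ∑ i, Real.exp (-(κ * a i))) ≤ 1 / 2 := by
    have h1 := (hlim.const_mul C).const_mul (Fintype.card (E ⊕ (I ⊕ I)) : ℝ)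
    rw [mul_zero, mul_zero] at h1
    exact h1.eventually (ge_mem_nhds (by norm_num))
  obtain ⟨β₁, hβ₁⟩ := Filter.eventually_atTop.1 hev
  -- 1 gives positivity, R bounds M because |k| ≥ Im k, and β₁ makes the line factors small enough
  -- for the geometric series.
  refine ⟨max 1 (max R β₁), lt_of_lt_of_le one_pos (le_max_left _ _), fun k hre him e e' => ?_⟩
  have him0 : 0 < k.im := lt_trans (lt_of_lt_of_le one_pos (le_max_left _ _)) him
  have hR : R < ‖k‖ := (((le_max_left _ _).trans (le_max_right _ _)).trans_lt him).trans_le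
    ((le_abs_self _).trans (Complex.abs_im_le_norm k))
  have hβ : β₁ ≤ k.im := (((le_max_right _ _).trans (le_max_right _ _)).trans_lt him).le
  have hM := hloc.mul_starSum_vertexScattering G hAB hre
  set M := G.starSum (G.vertexScattering Av Bv k) with hMdef
  have hu := hAB.isUnit_add hre
  have hOM := hAB.isUnit_add_sub_hop hre him0 ha
  rw [add_sub_hop_eq hM] at hOM
  have hu' : IsUnit (1 - M * hop E (lineFactor k a)) := by
    rw [Matrix.isUnit_iff_isUnit_det, Matrix.det_mul] at hOM
    exact (Matrix.isUnit_iff_isUnit_det _).2 (isUnit_of_mul_isUnit_right hOM)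
  have hS : IsScatteringMatrix A B k a (scatteringMatrix A B k a) :=
    Classical.epsilon_spec (existsUnique_isScatteringMatrix_of_det_ne_zero
      (hAB.det_outMat_ne_zero hre him0 ha)).exists
  obtain ⟨O, hO, hO'⟩ := (isScatteringMatrix_iff' hu hM a _).1 hS
  have h1 := hasSum_scores (hasSum_walk (G := G) (z := lineFactor k a)
    (fun x y h => G.starSum_apply_eq_zero _ h) (hCR k hre hR M hM)
    (Finset.sum_nonneg fun i _ => (Real.exp_pos (-(k.im * a i))).le) (fun i => ?_)
    (hβ₁ k.im hβ) hu' hO' e e')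
  · simp only [prod_lineFactor_pow] at h1
    rw [← hO]
    exact h1
  · have h2 : ‖lineFactor k a i‖ = Real.exp (-(k.im * a i)) := by
      rw [lineFactor, Complex.norm_exp]
      simp
    rw [h2]
    exact Finset.single_le_sum (f := fun i => Real.exp (-(k.im * a i)))
      (fun i _ => (Real.exp_pos _).le) (Finset.mem_univ i)

end Main

end LineGraph

theorem theorem5 {V E I : Type*} [Fintype V] [Fintype E] [Fintype I] [DecidableEq V]
    [DecidableEq E] [DecidableEq I] [Nonempty E]
    (G : LineGraph V E I) (hG : G.Connected)
    (A B : Matrix (E ⊕ (I ⊕ I)) (E ⊕ (I ⊕ I)) ℂ) (hAB : LineGraph.IsAdmissible A B)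
    (Av Bv : ∀ v, Matrix (G.Star v) (G.Star v) ℂ) (hloc : G.IsLocalWith A B Av Bv)
    (a : I → ℝ) (ha : ∀ i, 0 < a i) :
    -- the scattering matrix is well defined for `k > 0` and arbitrary real lengths
    (∀ k : ℝ, 0 < k → ∀ b : I → ℝ, ∃! S, LineGraph.IsScatteringMatrix A B (k : ℂ) b S) ∧
    -- and for `Re k > 0`, `Im k > 0` and the given lengths
    (∀ k : ℂ, 0 < k.re → 0 < k.im → ∃! S, LineGraph.IsScatteringMatrix A B k a S) ∧
    -- its values at complex `k` are the analytic continuation of those at `k > 0`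
    (∀ e e' : E,
      MeromorphicOn (fun k => LineGraph.scatteringMatrix A B k a e e') Set.univ ∧
      AnalyticOnNhd ℂ (fun k => LineGraph.scatteringMatrix A B k a e e')
        {k | 0 < k.re ∧ 0 < k.im}) ∧
    -- the coefficients are the analytic continuation of the Fourier coefficients at `k > 0`
    (∀ (n : I → ℕ) (e e' : E),
      AnalyticOnNhd ℂ (fun k => G.walkCoeff Av Bv k n e e') {k | 0 < k.re} ∧
      ∀ k : ℝ, 0 < k →
        MeasureTheory.IntegrableOn (LineGraph.fourierIntegrand A B k n e e')
          (Set.Icc (0 : I → ℝ) (fun _ => 2 * Real.pi / k)) ∧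
        G.walkCoeff Av Bv (k : ℂ) n e e' = LineGraph.fourierCoeff A B k n e e') ∧
    -- the expansion of the scattering matrix
    ∃ β₀ : ℝ, 0 < β₀ ∧ ∀ k : ℂ, 0 < k.re → β₀ < k.im → ∀ e e' : E,
      HasSum (fun n : G.scores e e' =>
          G.walkCoeff Av Bv k n e e' *
            Complex.exp (Complex.I * k * (LineGraph.pairing (n : I → ℕ) a : ℂ)))
        (LineGraph.scatteringMatrix A B k a e e') := by
  refine ⟨fun k hk b => ?_, fun k hre him => ?_, fun e e' => ⟨fun k _ => ?_, fun k hk => ?_⟩,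
    fun n e e' => ⟨fun k hk => ?_, fun k hk => ?_⟩, LineGraph.hasSum_walkCoeff G hAB hloc ha⟩
  · exact LineGraph.existsUnique_isScatteringMatrix_ofReal hAB hk b
      (hloc.mul_starSum_vertexScattering G hAB (by simpa using hk))
  · exact LineGraph.existsUnique_isScatteringMatrix_of_det_ne_zero
      (hAB.det_outMat_ne_zero hre him ha)
  · exact hAB.meromorphicAt_scatteringMatrix ha k e e'
  · exact LineGraph.analyticAt_scatteringMatrix (hAB.det_outMat_ne_zero hk.1 hk.2 ha) e e'
  · exact LineGraph.analyticAt_walkCoeff G hAB hloc hk n e e'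
  · rw [LineGraph.walkCoeff_eq_sum]
    exact LineGraph.integrableOn_fourierIntegrand_and_eq hAB
      (fun x y h => G.starSum_apply_eq_zero _ h) hk
      (hloc.mul_starSum_vertexScattering G hAB (by simpa using hk)) n e e'
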